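/- **Setting.** Let $\mathcal A=(\Sigma,\Psi,[\![\cdot]\!],\bot,\top,\vee,\wedge,\neg)$ be an effective Boolean algebra of predicates over a (possibly infinite) alphabet $\Sigma$. A symbolic finite automaton (SFA) $M=(\mathcal A,Q,Q_0,F,\Delta)$ has a finite set $Q$ of states, $Q_0,F\subseteq Q$ and a finite $\Delta\subseteq Q\times\Psi\times Q$; put $\delta(q,a)=\{q'\mid (q,\varphi,q')\in\Delta,\ a\in[\![\varphi]\!]\}$, extended to strings and to sets of states as usual, $L_q=\{w\mid\delta(q,w)\cap F\ne\emptyset\}$ and $L(M)=\bigcup_{q\in Q_0}L_q$. Let $u^{-1}L=\{v\mid uv\in L\}$ and $\mathit{Res}(L)=\{u^{-1}L\mid u\in\Sigma^*\}$. For a class $\mathbb L$ of sets let $\mathit{Prm}(\mathbb L)=\{K\in\mathbb L\mid K\ne\bigcup\{K'\in\mathbb L\mid K'\subsetneq K\}\}$. $M$ is a residual SFA (RSFA) if $L_q\in\mathit{Res}(L(M))$ for all $q\in Q$; it is reduced if $|Q|=|\mathit{Prm}(\mathit{Res}(L(M)))|$ and $L_q\in\mathit{Prm}(\mathit{Res}(L(M)))$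 for all $q\in Q$. The target $L_*$ is a language accepted by some SFA over $\mathcal A$. A minimally adequate teacher (MAT) for $L_*$ answers membership queries (MQs) "$w\in L_*$?" (by $+$ or $-$) and equivalence queries (EQs) "$L(\mathcal H)=L_*$?" (by "yes" or by an arbitrary counterexample from the symmetric difference). $\Lambda$ is a deterministic MAT learner for $\Psi$: with any MAT for any $[\![\varphi]\!]$, $\varphi\in\Psi$, it finds after finitely many queries a predicate with this denotation, and it finishes with a successful equivalence query. Queries of $\Lambda$ (mq, eq) are answered by the learner below. **The learner.** It keeps finite sets $U,V\subseteq\Sigma^*$, initially $U=V=\{\varepsilon\}$, and a table with the MQ answers on $UV$; let $\mathrm{row}(u)=\{v\in V\mid uv\in L_*\}$ for $u\in U$ (from the table), $\mathrm{Rows}=\{\mathrm{row}(u)\mid u\in U\}$, and, for other strings $x$, $\mathrm{tr}(x)=\{v\in V\mid \mathrm{MQ}(xv)=+\}$, found by $|V|$ MQs. *Extending* the table means enlarging $U$ and/or $V$, filling the new entries by MQs, and starting again with (B). Wherever an element has to be found or a loop run in some order, the choice is arbitrary. (B) *Build.* $Q=\{u\in U\mid\mathrm{row}(u)\in\mathit{Prm}(\mathrm{Rows})\}$,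 $Q_0=\{u\in Q\mid\mathrm{row}(u)\subseteq\mathrm{row}(\varepsilon)\}$, $F=\{u\in Q\mid\varepsilon\in\mathrm{row}(u)\}$. For every $(q,q')\in Q^2$ start a new instance $\Lambda^{(q,q')}$ and *update* $(q,q')$. Then go to (C). Updating $(q,q')$: run $\Lambda^{(q,q')}$ until it raises an eq on some $\varphi$; then suspend it, and $\varphi$ becomes the predicate on the edge from $q$ to $q'$. When it raises an mq on $a$, compute $t=\mathrm{tr}(qa)$; if $t\in\mathit{Prm}(\mathrm{Rows}\cup\{t\})\setminus\mathit{Prm}(\mathrm{Rows})$, extend $U$ by $qa$; otherwise answer $+$ iff $\mathrm{row}(q')\subseteq t$. *Giving $a$ to $(q,q')$* means answering the pending eq of $\Lambda^{(q,q')}$ by the counterexample $a$, updating $(q,q')$, and going to (C). (C) *Confirm*, in this order, for the current hypothesis $\mathcal H$: 1. If there are $q,q',x\in Q$ with $\mathrm{row}(q)\subseteq\mathrm{row}(q')$ and $a\in[\![\varphi\wedge\neg\varphi']\!]$, where $(q,\varphi,x),(q',\varphi',x)\in\Delta$: if $\mathrm{row}(x)\not\subseteq\mathrm{tr}(qa)$,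 give $a$ to $(q,x)$; otherwise, if $\mathrm{row}(x)\subseteq\mathrm{tr}(q'a)$, give $a$ to $(q',x)$; otherwise extend $V$ by $av$ for some $v\in\mathrm{row}(x)\setminus\mathrm{tr}(q'a)$. 2. If there are $u\in U\setminus\{\varepsilon\}$ and $x\in\delta(Q_0,u)$ with $\mathrm{row}(x)\not\subseteq\mathrm{row}(u)$, take such $u$ of minimal length, write $u=u'a$ with $a\in\Sigma$, and find $x'\in\delta(Q_0,u')$ with $x\in\delta(x',a)$: if $\mathrm{row}(x)\not\subseteq\mathrm{tr}(x'a)$, give $a$ to $(x',x)$; otherwise extend $V$ by $av$ for some $v\in\mathrm{tr}(x'a)\setminus\mathrm{row}(u)$. 3. If there is $v\in V\setminus\{\varepsilon\}$ with $v\in\mathrm{row}(q)\Leftrightarrow v\notin L_q$ for some $q\in Q$, find by binary search over the suffixes of $v$ (testing a suffix $s$ by the MQs on all $qs$, $q\in Q$) a suffix $av'$, $a\in\Sigma$, such that $\mathrm{MQ}(q_1v')=+\Leftrightarrow v'\in L_{q_1}$ for all $q_1\in Q$ and $\mathrm{MQ}(q_2av')=+\Leftrightarrow av'\notin L_{q_2}$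 for some $q_2\in Q$; compute $t=\mathrm{tr}(q_2a)$. If some $q_3\in Q$ has $\mathrm{row}(q_3)\subseteq t\Leftrightarrow q_3\notin\delta(q_2,a)$, give $a$ to $(q_2,q_3)$. Otherwise, if $\mathrm{MQ}(q_2av')=-$ or some $u\in U$ has $\mathrm{row}(u)=t$ and $\mathrm{MQ}(uv')=+$, extend $V$ by $v'$; otherwise extend $U$ by $q_2a$ and $V$ by $v'$. 4. If none of these applies, raise an EQ on $\mathcal H$. If the answer is "yes", return $\mathcal H$ and terminate; if it is a counterexample $w$, go to (P). (P) *Process $w$.* If $\bigvee_{q\in Q_0}\mathrm{MQ}(qw)\ne\mathrm{MQ}(w)$, extend $V$ by $w$. Otherwise find by binary search over the decompositions of $w$ (testing $w=xy$ by the MQs on $qy$, $q\in\delta(Q_0,x)$) a decomposition $w=uav$, $a\in\Sigma$, with $\bigvee_{q\in\delta(Q_0,u)}\mathrm{MQ}(qav)\ne\bigvee_{q'\in\delta(Q_0,ua)}\mathrm{MQ}(q'v)$. If some $q\in\delta(Q_0,u)$ has $\mathrm{MQ}(qav)=+$, take such a $q$ and compute $t=\mathrm{tr}(qa)$. If some $q'\in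 Q\setminus\delta(q,a)$ has $\mathrm{row}(q')\subseteq t$, give $a$ to $(q,q')$. Otherwise, if some $u'\in U$ has $\mathrm{row}(u')=t$ and $\mathrm{MQ}(u'v)=+$, extend $V$ by $v$; otherwise extend $U$ by $qa$ and $V$ by $v$. If there is no such $q$, find $q\in\delta(Q_0,u)$ and $q'\in\delta(q,a)$ with $\mathrm{MQ}(qav)=-$ and $\mathrm{MQ}(q'v)=+$. If $\mathrm{row}(q')\not\subseteq\mathrm{tr}(qa)$, give $a$ to $(q,q')$; otherwise extend $V$ by $v$. **Quantities.** Let $n=|\mathit{Res}(L_*)|$ and let $m$ be the length of the longest counterexample to an EQ returned by the MAT ($\log m$ is read as $0$ if $m=0$). For $L\in\mathit{Res}(L_*)$ let $\Gamma_L=\{\{a\in\Sigma\mid L'=a^{-1}L\}\mid L'\in\mathit{Res}(L_*)\}$, and let $\Phi=\{\bigcup S\mid S\subseteq\Gamma_L,\ L\in\mathit{Res}(L_*)\}$. Let $\mathcal E$ and $\mathcal M$ be upper bounds for the numbers of eqs and of mqs that $\Lambda$ raises in any interaction with a MAT for any $D\in\Phi$. **Theorem 2.** For every MAT for $L_*$,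 every run of the learner is finite, never gets stuck, and returns a reduced RSFA accepting $L_*$. There is an absolute constant $C$ such that at most $C\,n^4\mathcal E$ EQs are raised if $\mathcal E<\infty$, and at most $C\,\bigl(n^6(\mathcal E+\mathcal M)+n^5\mathcal E\log m\bigr)$ MQs if $\mathcal E,\mathcal M<\infty$. -/

import Mathlib

universe u v w

namespace RSFA

/-! ### Residual languages and primes -/

/-- The residual languages `u⁻¹L` of `L`. -/
def Res {α : Type u} (L : Language α) : Set (Language α) :=
  Set.range L.leftQuotient

/-- The prime members of a class of sets: those which are not the union of the members of the class
that they strictly contain. -/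
def Prm {X : Type u} (C : Set (Set X)) : Set (Set X) :=
  {L | L ∈ C ∧ L ≠ ⋃₀ {K | K ∈ C ∧ K ⊂ L}}

/-! ### Effective Boolean algebras and symbolic finite automata -/

/-- A Boolean algebra of predicates `Ψ` over the alphabet `α`. The laws are about denotations
only. (Decidability of emptiness and the ability to find an element of a non-empty denotation are
matters of computability; here the learner may pick any element of a non-empty denotation.) -/
structure PredAlg (α : Type u) (Ψ : Type v) where
  den : Ψ → Set α
  bot : Ψ
  top : Ψ
  or : Ψ → Ψ → Ψ
  and : Ψ → Ψ → Ψ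
  not : Ψ → Ψ
  den_bot : den bot = ∅
  den_top : den top = Set.univ
  den_or : ∀ φ ψ, den (or φ ψ) = den φ ∪ den ψ
  den_and : ∀ φ ψ, den (and φ ψ) = den φ ∩ den ψ
  den_not : ∀ φ, den (not φ) = (den φ)ᶜ

/-- A (non-deterministic) symbolic finite automaton over `A`, whose states are the elements of the
finite set `states`. -/
structure SFA {α : Type u} {Ψ : Type v} (A : PredAlg α Ψ) (S : Type w) where
  states : Finset S
  start : Finset S
  final : Finset S
  trans : Finset (S × Ψ × S)
  start_sub : start ⊆ states
  final_sub : final ⊆ states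
  trans_sub : ∀ t ∈ trans, t.1 ∈ states ∧ t.2.2 ∈ states

namespace SFA

variable {α : Type u} {Ψ : Type v} {A : PredAlg α Ψ} {S : Type w} (M : SFA A S)

/-- The induced transition function `δ(q, a)`. -/
def δ (q : S) (a : α) : Set S :=
  {r | ∃ φ, (q, φ, r) ∈ M.trans ∧ a ∈ A.den φ}

/-- The extension of `δ` to strings, `δ(q, w)`. -/
def δs : S → List α → Set S
  | q, [] => {q}
  | q, a :: x => {r | ∃ p ∈ M.δ q a, r ∈ δs p x}

/-- `δ(Q₀, w)`. -/
def reach (x : List α) : Set S :=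
  {r | ∃ q ∈ M.start, r ∈ M.δs q x}

/-- The language `L_q` accepted by the state `q`. -/
def langFrom (q : S) : Language α :=
  {x | ∃ r ∈ M.δs q x, r ∈ M.final}

/-- The language accepted by the automaton. -/
def lang : Language α :=
  {x | ∃ q ∈ M.start, x ∈ M.langFrom q}

/-- `M` is a residual SFA. -/
def IsResidual : Prop :=
  ∀ q ∈ M.states, M.langFrom q ∈ Res M.lang

/-- The condition for a residual SFA to be reduced. -/
def IsReduced : Prop :=
  M.states.card = (Prm (Res M.lang)).ncard ∧ ∀ q ∈ M.states, M.langFrom q ∈ Prm (Res M.lang)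

end SFA

/-! ### Learners for predicates -/

/-- A query of a predicate learner: a membership query on a letter, or an equivalence query on a
predicate. -/
inductive Query (α : Type u) (Ψ : Type v)
  | mq (a : α)
  | eq (φ : Ψ)

/-- An answer to a predicate learner: the answer to a membership query, or a counterexample to an
equivalence query. (After the answer "yes" the learner is finished.) -/
inductive Answer (α : Type u)
  | mq (b : Bool)
  | ce (a : α)

/-- A predicate learner: it determines its next query from the answers obtained so far
(latest answer first). -/
abbrev PredLearner (α : Type u) (Ψ : Type v) := List (Answer α) → Query α Ψ

section PredLearner

variable {α : Type u} {Ψ : Type v} (A : PredAlg α Ψ) (Λ : PredLearner α Ψ)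

open Classical in
/-- `h` is the list of answers in some interaction of `Λ`, not finished yet, with a minimally
adequate teacher for the set `D`. -/
inductive Interaction (D : Set α) : List (Answer α) → Prop
  | nil : Interaction D []
  | mq {h : List (Answer α)} {a : α} : Interaction D h → Λ h = .mq a →
      Interaction D (.mq (decide (a ∈ D)) :: h)
  | ce {h : List (Answer α)} {φ : Ψ} {a : α} : Interaction D h → Λ h = .eq φ →
      (a ∈ D ↔ a ∉ A.den φ) → Interaction D (.ce a :: h)

/-- `Λ` learns `D` from every minimally adequate teacher: no interaction goes on forever. (An
interaction that cannot be continued has arrived at an equivalence query on a predicate that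
denotes `D`.) -/
def Learns (D : Set α) : Prop :=
  ¬ ∃ f : ℕ → List (Answer α), f 0 = [] ∧
    ∀ i, Interaction A Λ D (f i) ∧ ∃ r, f (i + 1) = r :: f i

/-- `Λ` is a MAT learner for the predicate algebra `A`. -/
def IsMATLearner : Prop :=
  ∀ φ : Ψ, Learns A Λ (A.den φ)

/-- Number of equivalence queries raised by `Λ` up to the moment at which it has got the answers
`h` and raised its next query. -/
def numEQ (h : List (Answer α)) : ℕ :=
  h.countP (fun r => match r with | .mq _ => false | .ce _ => true) +
    (match Λ h with | .mq _ => 0 | .eq _ => 1)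

/-- Number of membership queries raised by `Λ` up to the moment at which it has got the answers
`h` and raised its next query. -/
def numMQ (h : List (Answer α)) : ℕ :=
  h.countP (fun r => match r with | .mq _ => true | .ce _ => false) +
    (match Λ h with | .mq _ => 1 | .eq _ => 0)

/-- The worst-case number of equivalence queries of `Λ` on the target set `D`. -/
noncomputable def costEQ (D : Set α) : ℕ∞ :=
  ⨆ (h : List (Answer α)) (_ : Interaction A Λ D h), (numEQ Λ h : ℕ∞)

/-- The worst-case number of membership queries of `Λ` on the target set `D`. -/
noncomputable def costMQ (D : Set α) : ℕ∞ :=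
  ⨆ (h : List (Answer α)) (_ : Interaction A Λ D h), (numMQ Λ h : ℕ∞)

/-- `Γ_K`, the partition of the alphabet according to the residual `a⁻¹K` (possibly together with
the empty set), where `K` is a residual language of `L`. -/
def letterClasses (L K : Language α) : Set (Set α) :=
  {D | ∃ K' ∈ Res L, D = {a | K' = K.leftQuotient [a]}}

/-- `Φ`, the predicate sets that can arise in the learning of `L`. -/
def arisingSets (L : Language α) : Set (Set α) :=
  {D | ∃ K ∈ Res L, ∃ S ⊆ letterClasses L K, D = ⋃₀ S}

/-- `𝓔`, the maximum of the worst-case numbers of equivalence queries of `Λ` on the predicate sets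
that can arise. -/
noncomputable def maxEQ (L : Language α) : ℕ∞ :=
  ⨆ D ∈ arisingSets L, costEQ A Λ D

/-- `𝓜`, the same for membership queries. -/
noncomputable def maxMQ (L : Language α) : ℕ∞ :=
  ⨆ D ∈ arisingSets L, costMQ A Λ D

end PredLearner

/-! ### Query programs

A program accesses the target language only through the constructors `mq` and `eq`. The programs
are well-founded trees; loops are obtained from jumps to control points `s : Γ`. -/

/-- Programs with control points in `Γ` and hypotheses in `H`. -/
inductive Prog (α : Type u) (H : Type v) (Γ : Type w) : Type (max (u + 1) v w)
  /-- raise a membership query on `x` and go on according to the answer -/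
  | mq (x : List α) (k : Bool → Prog α H Γ) : Prog α H Γ
  /-- raise an equivalence query on `h`; go on with `yes`, or with `no x` if the teacher returns
  the counterexample `x` -/
  | eq (h : H) (yes : Prog α H Γ) (no : List α → Prog α H Γ) : Prog α H Γ
  /-- find an (arbitrary) element of `S`; the program is stuck if `S` is empty -/
  | pick {ι : Type u} (S : Set ι) (k : ι → Prog α H Γ) : Prog α H Γ
  /-- jump to the control point `s` -/
  | goto (s : Γ) : Prog α H Γ
  /-- terminate and return `h` -/
  | halt (h : H) : Prog α H Γ

/-- A configuration of a running learner: the rest of the program, the numbers of equivalence and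
membership queries raised so far, and the length of the longest counterexample returned so far
by the teacher (`0` if there is none). -/
structure Config (α : Type u) (H : Type v) (Γ : Type w) : Type (max (u + 1) v w) where
  prog : Prog α H Γ
  eqs : ℕ
  mqs : ℕ
  maxCE : ℕ

open Classical in
/-- One step of a learner whose control points carry the programs `body`, when the teacher is a
minimally adequate teacher for `L`. -/
inductive Step {α : Type u} {H : Type v} {Γ : Type w} (body : Γ → Prog α H Γ)
    (langOf : H → Language α) (L : Language α) : Config α H Γ → Config α H Γ → Prop
  | mq (x : List α) (k : Bool → Prog α H Γ) (e c m : ℕ) :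
      Step body langOf L ⟨.mq x k, e, c, m⟩ ⟨k (decide (x ∈ L)), e, c + 1, m⟩
  | eq_yes (h : H) (yes : Prog α H Γ) (no : List α → Prog α H Γ) (e c m : ℕ) :
      langOf h = L → Step body langOf L ⟨.eq h yes no, e, c, m⟩ ⟨yes, e + 1, c, m⟩
  | eq_no (h : H) (yes : Prog α H Γ) (no : List α → Prog α H Γ) (e c m : ℕ) (x : List α) :
      (x ∈ L ↔ x ∉ langOf h) →
      Step body langOf L ⟨.eq h yes no, e, c, m⟩ ⟨no x, e + 1, c, max m x.length⟩
  | pick {ι : Type u} (S : Set ι) (k : ι → Prog α H Γ) (e c m : ℕ) (i : ι) :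
      i ∈ S → Step body langOf L ⟨.pick S k, e, c, m⟩ ⟨k i, e, c, m⟩
  | goto (s : Γ) (e c m : ℕ) : Step body langOf L ⟨.goto s, e, c, m⟩ ⟨body s, e, c, m⟩

section Combinators

variable {α : Type u} {H : Type v} {Γ : Type w}

open Classical in
/-- Find an element of `S` and go on with `k`; if there is none, go on with `p`. This also renders
a loop through `S`, in an arbitrary order, whose body is left for good by the first element that
satisfies a condition (the condition being part of `S`). -/
noncomputable def pickOr {ι : Type u} (S : Set ι) (k : ι → Prog α H Γ) (p : Prog α H Γ) :
    Prog α H Γ :=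
  if S.Nonempty then .pick S k else p

open Classical in
/-- Raise a membership query on each string of a list, and go on with the set of those strings for
which the answer is `+`. -/
noncomputable def askSet : List (List α) → (Set (List α) → Prog α H Γ) → Prog α H Γ
  | [], k => k ∅
  | x :: l, k => .mq x fun b => askSet l fun P => k (if b then insert x P else P)

/-- Determine `{v ∈ V | MQ(xv) = +}` by membership queries. -/
noncomputable def askRow (x : List α) (V : Finset (List α)) (k : Set (List α) → Prog α H Γ) :
    Prog α H Γ :=
  askSet (V.toList.map (x ++ ·)) fun P => k {y | y ∈ V ∧ x ++ y ∈ P}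

/-- Binary search. If the test is positive at `lo` and negative at `lo + len`, then an `i` is found
with `lo ≤ i < lo + len` such that the test is positive at `i` and negative at `i + 1`. -/
def bsearch (test : ℕ → (Bool → Prog α H Γ) → Prog α H Γ) (lo len : ℕ) (k : ℕ → Prog α H Γ) :
    Prog α H Γ :=
  if _hlen : len ≤ 1 then k lo
  else test (lo + len / 2) fun b =>
    if b then bsearch test (lo + len / 2) (len - len / 2) k
    else bsearch test lo (len / 2) k
termination_by len
decreasing_by all_goals omega

end Combinators

/-! ### Observation tables and hypotheses -/

/-- An observation table: `pos` is the set of the strings in `UV` for which the table has the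
entry `+`. -/
structure Table (α : Type u) where
  U : Finset (List α)
  V : Finset (List α)
  pos : Set (List α)

namespace Table

variable {α : Type u} (T : Table α)

def row (x : List α) : Set (List α) := {y | y ∈ T.V ∧ x ++ y ∈ T.pos}

def rows : Set (Set (List α)) := {r | ∃ x ∈ T.U, r = T.row x}

open Classical in
/-- The states `Q` of the hypothesis. -/
noncomputable def Q : Finset (List α) := T.U.filter fun x => T.row x ∈ Prm T.rows

open Classical in
/-- The initial states of the hypothesis. -/
noncomputable def Q₀ : Finset (List α) := T.Q.filter fun x => T.row x ⊆ T.row []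

open Classical in
/-- The final states of the hypothesis. -/
noncomputable def F : Finset (List α) := T.Q.filter fun x => [] ∈ T.row x

end Table

/-- The answers that the instances `Λ^(q,q')` of the predicate learner have got so far. -/
abbrev Hist (α : Type u) := List α → List α → List (Answer α)

open Classical in
/-- Give the answer `r` to the instance `Λ^(q,q')`. -/
noncomputable def Hist.give {α : Type u} (h : Hist α) (q q' : List α) (r : Answer α) : Hist α :=
  fun x y => if x = q ∧ y = q' then r :: h q q' else h x y

section Hypothesis

variable {α : Type u} {Ψ : Type v} (A : PredAlg α Ψ) (Λ : PredLearner α Ψ) (T : Table α)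
  (h : Hist α)

open Classical in
/-- The transitions of the hypothesis: the edge from `q` to `q'` carries the predicate on which
`Λ^(q,q')` has its equivalence query pending. -/
noncomputable def hypTrans : Finset (List α × Ψ × List α) :=
  (T.Q ×ˢ T.Q).biUnion fun p =>
    match Λ (h p.1 p.2) with
    | .mq _ => ∅
    | .eq φ => {(p.1, φ, p.2)}

/-- The hypothesis automaton. -/
noncomputable def hyp : SFA A (List α) where
  states := T.Q
  start := T.Q₀
  final := T.F
  trans := hypTrans Λ T h
  start_sub := by classical exact Finset.filter_subset _ _
  final_sub := by classical exact Finset.filter_subset _ _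
  trans_sub := by
    intro t ht
    simp only [hypTrans, Finset.mem_biUnion, Finset.mem_product] at ht
    obtain ⟨p, hp, ht⟩ := ht
    split at ht
    · simp at ht
    · rw [Finset.mem_singleton] at ht
      subst ht
      exact hp

end Hypothesis

/-! ### The learner -/

/-- The control points of the learner. -/
inductive Ctrl (α : Type u)
  /-- start to build a hypothesis from the table -/
  | build (T : Table α)
  /-- `update_transition` for the pair `(q, q')`; the pairs in `todo` remain to be treated before
  the building of the hypothesis is complete -/
  | update (T : Table α) (h : Hist α) (q q' : List α) (todo : Finset (List α × List α))
  /-- `confirm_conditions`, and then an equivalence query -/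
  | confirm (T : Table α) (h : Hist α)

section Learner

variable {α : Type u} {Ψ : Type v} (A : PredAlg α Ψ) (Λ : PredLearner α Ψ)

/-- Programs of the learner. -/
abbrev LProg := Prog α (SFA A (List α)) (Ctrl α)

open Classical in
/-- Extend the table to `U'`, `V'`, fill the new entries by membership queries, and start building a
hypothesis from scratch. -/
noncomputable def extend (T : Table α) (U' V' : Finset (List α)) : LProg A :=
  askSet (Finset.image₂ (· ++ ·) U' V' \ Finset.image₂ (· ++ ·) T.U T.V).toList fun P =>
    .goto (.build ⟨U', V', T.pos ∪ P⟩)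

open Classical in
/-- Go on with the pairs in `todo`, in an arbitrary order, and then confirm the conditions. -/
noncomputable def continueBuild (T : Table α) (h : Hist α) (todo : Finset (List α × List α)) :
    LProg A :=
  pickOr {p | p ∈ todo} (fun p => .goto (.update T h p.1 p.2 (todo.erase p)))
    (.goto (.confirm T h))

/-- `build_hypothesis` -/
noncomputable def buildHypothesis (T : Table α) : LProg A :=
  continueBuild A T (fun _ _ => []) (T.Q ×ˢ T.Q)

open Classical in
/-- `update_transition` for the pair `(q, q')` (one round of its loop) -/
noncomputable def updateTransition (T : Table α) (h : Hist α) (q q' : List α)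
    (todo : Finset (List α × List α)) : LProg A :=
  match Λ (h q q') with
  | .mq a =>
      askRow (q ++ [a]) T.V fun tempRow =>
        if tempRow ∈ Prm (T.rows ∪ {tempRow}) \ Prm T.rows then
          extend A T (insert (q ++ [a]) T.U) T.V
        else
          .goto (.update T (h.give q q' (.mq (decide (T.row q' ⊆ tempRow)))) q q' todo)
  | .eq _ => continueBuild A T h todo

/-- Give `a` to `Λ^(q,q')` as a counterexample, update the transition, and confirm the conditions
again. -/
noncomputable def giveCE (T : Table α) (h : Hist α) (q q' : List α) (a : α) : LProg A :=
  .goto (.update T (h.give q q' (.ce a)) q q' ∅)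

open Classical in
/-- Confirm Condition 1, and then go on with `p`. -/
noncomputable def confirm1 (T : Table α) (h : Hist α) (p : LProg A) : LProg A :=
  pickOr {t : List α × List α × List α × α | ∃ q q' x a, t = (q, q', x, a) ∧
      q ∈ T.Q ∧ q' ∈ T.Q ∧ T.row q ⊆ T.row q' ∧ x ∈ T.Q ∧
      ∃ φ φ', (q, φ, x) ∈ (hyp A Λ T h).trans ∧ (q', φ', x) ∈ (hyp A Λ T h).trans ∧
        a ∈ A.den (A.and φ (A.not φ'))}
    (fun (q, q', x, a) =>
      askRow (q ++ [a]) T.V fun r =>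
        if ¬ T.row x ⊆ r then giveCE A T h q x a
        else askRow (q' ++ [a]) T.V fun r' =>
          if T.row x ⊆ r' then giveCE A T h q' x a
          else .pick {y | y ∈ T.V ∧ y ∈ T.row x ∧ y ∉ r'} fun y =>
            extend A T T.U (insert (a :: y) T.V))
    p

open Classical in
/-- Confirm Condition 2, and then go on with `p`. -/
noncomputable def confirm2 (T : Table α) (h : Hist α) (p : LProg A) : LProg A :=
  pickOr {t : List α × List α | ∃ x s, t = (x, s) ∧ x ∈ T.U ∧ x ≠ [] ∧
      (∀ x' ∈ T.U, x' ≠ [] → x'.length < x.length →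
        ∀ s' ∈ (hyp A Λ T h).reach x', T.row s' ⊆ T.row x') ∧
      s ∈ (hyp A Λ T h).reach x ∧ ¬ T.row s ⊆ T.row x}
    (fun (x, s) =>
      .pick {t : List α × α × List α | ∃ x' a s', t = (x', a, s') ∧ x = x' ++ [a] ∧
          s' ∈ (hyp A Λ T h).reach x' ∧ s ∈ (hyp A Λ T h).δ s' a} fun (_, a, s') =>
        askRow (s' ++ [a]) T.V fun r =>
          if ¬ T.row s ⊆ r then giveCE A T h s' s a
          else .pick {y | y ∈ T.V ∧ y ∈ r ∧ y ∉ T.row x} fun y =>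
            extend A T T.U (insert (a :: y) T.V))
    p

open Classical in
/-- Extend the table by `y` in `V` if some `x ∈ U` with `row(x) = r` has `MQ(xy) = +`, and otherwise
by `z` in `U` and `y` in `V`. -/
noncomputable def extendBySuffix (T : Table α) (r : Set (List α)) (z y : List α) : LProg A :=
  askSet ((T.U.filter fun x => T.row x = r).toList.map (· ++ y)) fun P =>
    if ∃ x ∈ T.U, T.row x = r ∧ x ++ y ∈ P then extend A T T.U (insert y T.V)
    else extend A T (insert z T.U) (insert y T.V)

open Classical in
/-- Confirm Condition 3, and then go on with `p`. -/
noncomputable def confirm3 (T : Table α) (h : Hist α) (p : LProg A) : LProg A :=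
  pickOr {y | y ∈ T.V ∧ y ≠ [] ∧
      ∃ q ∈ T.Q, (y ∈ T.row q ↔ y ∉ (hyp A Λ T h).langFrom q)}
    (fun y =>
      bsearch
        (fun i k => askSet (T.Q.toList.map (· ++ y.drop i)) fun P =>
          k (decide (∃ q ∈ T.Q, (q ++ y.drop i ∈ P ↔ y.drop i ∉ (hyp A Λ T h).langFrom q))))
        0 y.length fun i =>
      .pick {t : α × List α | y.drop i = t.1 :: t.2} fun (a, y') =>
      askSet (T.Q.toList.map (· ++ a :: y')) fun P =>
      .pick {q | q ∈ T.Q ∧ (q ++ a :: y' ∈ P ↔ a :: y' ∉ (hyp A Λ T h).langFrom q)} fun q₂ =>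
      askRow (q₂ ++ [a]) T.V fun tempRow =>
      pickOr {q | q ∈ T.Q ∧ (T.row q ⊆ tempRow ↔ q ∉ (hyp A Λ T h).δ q₂ a)}
        (fun q₃ => giveCE A T h q₂ q₃ a)
        (if q₂ ++ a :: y' ∉ P then extend A T T.U (insert y' T.V)
        else extendBySuffix A T tempRow (q₂ ++ [a]) y'))
    p

open Classical in
/-- The states of the hypothesis that are reached by reading `x`. -/
noncomputable def reachFinset (T : Table α) (h : Hist α) (x : List α) : Finset (List α) :=
  T.Q.filter fun q => q ∈ (hyp A Λ T h).reach x

open Classical in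
/-- `process_counterexample`, for the counterexample `x` -/
noncomputable def handleCE (T : Table α) (h : Hist α) (x : List α) : LProg A :=
  askSet (x :: T.Q₀.toList.map (· ++ x)) fun P =>
  if ¬ ((∃ q ∈ T.Q₀, q ++ x ∈ P) ↔ x ∈ P) then extend A T T.U (insert x T.V)
  else
    bsearch
      (fun i k => askSet ((reachFinset A Λ T h (x.take i)).toList.map (· ++ x.drop i)) fun R =>
        k (decide ((∃ q ∈ reachFinset A Λ T h (x.take i), q ++ x.drop i ∈ R) ↔ x ∈ P)))
      0 x.length fun i =>
    .pick {t : α × List α | x.drop i = t.1 :: t.2} fun (a, y) =>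
    askSet ((reachFinset A Λ T h (x.take i)).toList.map (· ++ a :: y)) fun R =>
    if ∃ q ∈ reachFinset A Λ T h (x.take i), q ++ a :: y ∈ R then
      .pick {q | q ∈ reachFinset A Λ T h (x.take i) ∧ q ++ a :: y ∈ R} fun q =>
      askRow (q ++ [a]) T.V fun tempRow =>
      pickOr {q' | q' ∈ T.Q ∧ T.row q' ⊆ tempRow ∧ q' ∉ (hyp A Λ T h).δ q a}
        (fun q' => giveCE A T h q q' a)
        (extendBySuffix A T tempRow (q ++ [a]) y)
    else
      askSet ((reachFinset A Λ T h (x.take i ++ [a])).toList.map (· ++ y)) fun R' =>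
      .pick {t : List α × List α | t.1 ∈ reachFinset A Λ T h (x.take i) ∧
          t.2 ∈ (hyp A Λ T h).δ t.1 a ∧ t.1 ++ a :: y ∉ R ∧ t.2 ++ y ∈ R'} fun (q, q') =>
      askRow (q ++ [a]) T.V fun tempRow =>
      if ¬ T.row q' ⊆ tempRow then giveCE A T h q q' a
      else extend A T T.U (insert y T.V)

/-- The program of the learner at each control point. -/
noncomputable def learner : Ctrl α → LProg A
  | .build T => buildHypothesis A T
  | .update T h q q' todo => updateTransition A Λ T h q q' todo
  | .confirm T h =>
      confirm1 A Λ T h <| confirm2 A Λ T h <| confirm3 A Λ T h <|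
        .eq (hyp A Λ T h) (.halt (hyp A Λ T h)) fun x => handleCE A Λ T h x

/-- Configurations of the learner. -/
abbrev LConfig := Config α (SFA A (List α)) (Ctrl α)

/-- The initial configuration: the learner begins by filling the table with `U = V = {ε}`. -/
noncomputable def initial : LConfig A :=
  ⟨extend A ⟨∅, ∅, ∅⟩ {[]} {[]}, 0, 0, 0⟩

/-- One step of the learner, using the predicate learner `Λ`, with a minimally adequate teacher for
`L`. -/
def LStep (L : Language α) : LConfig A → LConfig A → Prop :=
  Step (learner A Λ) SFA.lang L

/-- `c` can occur in a run of the learner with some minimally adequate teacher for `L`. -/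
def Reachable (L : Language α) (c : LConfig A) : Prop :=
  Relation.ReflTransGen (LStep A Λ L) (initial A) c

end Learner

end RSFA

/-! Fix the table and write `n` for the number of residuals. The instance of `Λ` for an edge from
`q` to `q'` has a fixed goal, `target L V q q'`: the letters `a` for which the row of `q'` lies
below that of `qa`. This depends only on the residual of `qa`, so the goal is one of the sets that
can arise (`target_mem_arising`); as such it is denoted by a predicate (`exists_den_of_arising`),
and `Λ` learns it. Every answer given to an instance is correct for its goal, so an instance cannot
be consulted forever while the table stays the same.

The table can be extended only boundedly often. The potential `progress` adds the number of
non-inclusions of residuals witnessed in `V`, the number `(n + 1)|U|`, and `|Q|`. Elements of `U`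
keep distinct rows, so `|U| ≤ n` and the potential is at most `4n²`. An extension raises it because
a suffix refutes an inclusion of rows (`progress_lt_of_split`), makes a further row prime
(`progress_lt_of_uncovered`), or comes with a new row (`progress_lt_of_new_row`). Every violated
condition and every counterexample is traced to one letter, where either an edge is wrong, so that
its instance gets a genuine counterexample, or one of these three events occurs.

If the conditions hold and the equivalence query succeeds, the hypothesis is a reduced RSFA
(`isResidual_isReduced_of_conditions`).

For the counts, each failed EQ leads to an extension or to a counterexample for one of at most `n²`
instances. This gives about `n² · n²E` EQs. Between two extensions there are at most `n²K` answers,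
each costing one row of at most `4n²` MQs, and `n²E` rounds of cost `O(n² + n log m)`.

Termination is claimed even if `Λ` has no finite worst-case cost. Hence the rank of a control point
is lexicographic: the remaining potential, then the ordinal ranks of the interactions with the
instances, then the number of edges left. `Sat` is a weakest-precondition calculus for query
programs, and `Sat.acc` turns a decrease of rank at every jump into termination. -/

namespace RSFA

/-! ### A program logic for query programs -/

section Sat

variable {α : Type u} {H : Type v} {Γ : Type w}

open Classical in
/-- `Sat langOf L G Y B p e c m`: whatever the teacher for `L` answers, the program `p`, started
with counters `e`, `c`, `m`, does not get stuck, jumps only to control points satisfying `G`, returns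
only hypotheses satisfying `Y`, and respects the bound `B` on the counters. -/
def Sat (langOf : H → Language α) (L : Language α) (G : Γ → ℕ → ℕ → ℕ → Prop) (Y : H → Prop)
    (B : ℕ → ℕ → ℕ → Prop) : Prog α H Γ → ℕ → ℕ → ℕ → Prop
  | .mq x k, e, c, m => Sat langOf L G Y B (k (decide (x ∈ L))) e (c + 1) m
  | .eq h yes no, e, c, m => B e c m ∧
      (langOf h = L → Sat langOf L G Y B yes (e + 1) c m) ∧
      ∀ x, (x ∈ L ↔ x ∉ langOf h) → Sat langOf L G Y B (no x) (e + 1) c (max m x.length)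
  | .pick S k, e, c, m => S.Nonempty ∧ ∀ i ∈ S, Sat langOf L G Y B (k i) e c m
  | .goto s, e, c, m => B e c m ∧ G s e c m
  | .halt h, e, c, m => B e c m ∧ Y h

variable {langOf : H → Language α} {L : Language α} {G : Γ → ℕ → ℕ → ℕ → Prop} {Y : H → Prop}
  {B : ℕ → ℕ → ℕ → Prop} (hB : ∀ e c c' m, c' ≤ c → B e c m → B e c' m)
  (hG : ∀ s e c c' m, c' ≤ c → G s e c m → G s e c' m)

include hB in
-- `B` is demanded only at equivalence queries, jumps and the end. Until such a point only the
-- counter `c` grows, and `B` is antitone in it.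
theorem Sat.bound {p : Prog α H Γ} {e c m : ℕ} (h : Sat langOf L G Y B p e c m) : B e c m := by
  induction p generalizing e c m with
  | mq x k ih => exact hB _ _ _ _ (Nat.le_succ c) (ih _ h)
  | eq => exact h.1
  | pick S k ih =>
    obtain ⟨⟨i, hi⟩, h⟩ := h
    exact ih i (h i hi)
  | goto => exact h.1
  | halt => exact h.1

include hB hG in
theorem Sat.antitone {p : Prog α H Γ} {e c m : ℕ} (h : Sat langOf L G Y B p e c m) {c' : ℕ}
    (hc : c' ≤ c) : Sat langOf L G Y B p e c' m := by
  induction p generalizing e c c' m with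
  | mq x k ih => exact ih _ h (Nat.succ_le_succ hc)
  | eq q yes no ihy ihn =>
    exact ⟨hB _ _ _ _ hc h.1, fun hq => ihy (h.2.1 hq) hc, fun x hx => ihn x (h.2.2 x hx) hc⟩
  | pick S k ih => exact ⟨h.1, fun i hi => ih i (h.2 i hi) hc⟩
  | goto s => exact ⟨hB _ _ _ _ hc h.1, hG _ _ _ _ _ hc h.2⟩
  | halt => exact ⟨hB _ _ _ _ hc h.1, h.2⟩

theorem Sat.mono {G' : Γ → ℕ → ℕ → ℕ → Prop} (hGG : ∀ s e c m, G s e c m → G' s e c m)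
    {p : Prog α H Γ} {e c m : ℕ} (h : Sat langOf L G Y B p e c m) :
    Sat langOf L G' Y B p e c m := by
  induction p generalizing e c m with
  | mq x k ih => exact ih _ h
  | eq q yes no ihy ihn =>
    exact ⟨h.1, fun hq => ihy (h.2.1 hq), fun x hx => ihn x (h.2.2 x hx)⟩
  | pick S k ih => exact ⟨h.1, fun i hi => ih i (h.2 i hi)⟩
  | goto s => exact ⟨h.1, hGG _ _ _ _ h.2⟩
  | halt => exact h

theorem sat_pickOr {ι : Type u} {S : Set ι} {k : ι → Prog α H Γ} {p : Prog α H Γ} {e c m : ℕ}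
    (hk : ∀ i ∈ S, Sat langOf L G Y B (k i) e c m) (hp : S = ∅ → Sat langOf L G Y B p e c m) :
    Sat langOf L G Y B (pickOr S k p) e c m := by
  unfold pickOr
  split_ifs with h
  · exact ⟨h, hk⟩
  · exact hp (Set.not_nonempty_iff_eq_empty.1 h)

theorem sat_askSet {l : List (List α)} {k : Set (List α) → Prog α H Γ} {e c m : ℕ}
    (hk : Sat langOf L G Y B (k {x | x ∈ l ∧ x ∈ L}) e (c + l.length) m) :
    Sat langOf L G Y B (askSet l k) e c m := by
  induction l generalizing k c with
  | nil => simpa [askSet] using hk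
  | cons x l ih =>
    unfold askSet
    simp only [Sat]
    apply ih
    convert hk using 1
    · congr 1
      by_cases hx : x ∈ L
      · ext y; simp only [hx, decide_true, if_true, List.mem_cons, Set.mem_insert_iff,
          Set.mem_ofPred_eq]
        constructor
        · rintro (rfl | h)
          · exact ⟨.inl rfl, hx⟩
          · exact ⟨.inr h.1, h.2⟩
        · rintro ⟨rfl | h, h'⟩
          · exact .inl rfl
          · exact .inr ⟨h, h'⟩
      · ext y; simp only [hx, decide_false, List.mem_cons, Set.mem_ofPred_eq, Bool.false_eq_true,
          if_false]
        constructor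
        · rintro h
          exact ⟨.inr h.1, h.2⟩
        · rintro ⟨rfl | h, h'⟩
          · exact absurd h' hx
          · exact ⟨h, h'⟩
    · simp only [List.length_cons]; omega

/-- The set of the strings in `V` that lead from `x` into `L`. -/
def tr (L : Language α) (V : Finset (List α)) (x : List α) : Set (List α) :=
  {y | y ∈ V ∧ x ++ y ∈ L}

theorem sat_askRow {x : List α} {V : Finset (List α)} {k : Set (List α) → Prog α H Γ} {e c m : ℕ}
    (hk : Sat langOf L G Y B (k (tr L V x)) e (c + V.card) m) :
    Sat langOf L G Y B (askRow x V k) e c m := by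
  apply sat_askSet
  convert hk using 2
  · ext y
    simp only [tr, List.mem_map, Finset.mem_toList, Set.mem_ofPred_eq]
    constructor
    · rintro ⟨h1, -, h2⟩; exact ⟨h1, h2⟩
    · rintro ⟨h1, h2⟩; exact ⟨h1, ⟨y, h1, rfl⟩, h2⟩
  · simp

open Classical in
include hB hG in
-- Even the larger half, of length `len - len / 2`, has a rounded-up binary logarithm smaller by
-- one, which pays for the test. For the smaller half the bound has room to spare.
theorem sat_bsearch {test : ℕ → (Bool → Prog α H Γ) → Prog α H Γ} {t : ℕ → Prop} {wt : ℕ}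
    {k : ℕ → Prog α H Γ} {e m : ℕ}
    (htest : ∀ i k c, Sat langOf L G Y B (k (decide (t i))) e (c + wt) m →
      Sat langOf L G Y B (test i k) e c m)
    {lo len c : ℕ} (hlo : t lo) (hhi : ¬ t (lo + len))
    (hk : ∀ i, lo ≤ i → i < lo + len → t i → ¬ t (i + 1) →
      Sat langOf L G Y B (k i) e (c + wt * Nat.clog 2 len) m) :
    Sat langOf L G Y B (bsearch test lo len k) e c m := by
  induction len using Nat.strong_induction_on generalizing lo c with
  | _ len ih =>
  rw [bsearch]
  have hlen0 : len ≠ 0 := by rintro rfl; exact hhi hlo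
  split_ifs with hlen
  · have : len = 1 := by omega
    subst this
    simpa using hk lo le_rfl (by omega) hlo hhi
  · have hcl : Nat.clog 2 len = Nat.clog 2 (len - len / 2) + 1 := by
      rw [Nat.clog_of_two_le (by omega) (by omega)]
      congr 2; omega
    have hcl' : Nat.clog 2 (len / 2) ≤ Nat.clog 2 (len - len / 2) :=
      Nat.clog_mono_right _ (by omega)
    apply htest
    by_cases ht : t (lo + len / 2)
    · simp only [ht, decide_true, if_true]
      refine ih _ (by omega) ht (by rwa [show lo + len / 2 + (len - len / 2) = lo + len by omega])
        ?_
      intro i h1 h2 h3 h4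
      refine (hk i (by omega) (by omega) h3 h4).antitone hB hG ?_
      rw [hcl]; ring_nf; rfl
    · simp only [ht, decide_false, Bool.false_eq_true, if_false]
      refine ih _ (by omega) hlo ht ?_
      intro i h1 h2 h3 h4
      refine (hk i (by omega) (by omega) h3 h4).antitone hB hG ?_
      rw [hcl]; nlinarith

end Sat

/-! ### Soundness of the logic -/

section Soundness

variable {α : Type u} {H : Type v} {Γ : Type w} {body : Γ → Prog α H Γ} {langOf : H → Language α}
  {L : Language α} {Inv : Γ → ℕ → ℕ → ℕ → Prop} {Y : H → Prop} {B : ℕ → ℕ → ℕ → Prop}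

theorem Sat.step (hbody : ∀ s e c m, Inv s e c m → Sat langOf L Inv Y B (body s) e c m)
    {a b : Config α H Γ} (h : Sat langOf L Inv Y B a.prog a.eqs a.mqs a.maxCE)
    (hab : Step body langOf L a b) : Sat langOf L Inv Y B b.prog b.eqs b.mqs b.maxCE := by
  cases hab with
  | mq x k e c m => exact h
  | eq_yes q yes no e c m hq => exact h.2.1 hq
  | eq_no q yes no e c m x hx => exact h.2.2 x hx
  | pick S k e c m i hi => exact h.2 i hi
  | goto s e c m => exact hbody _ _ _ _ h.2

theorem Sat.reachable (hbody : ∀ s e c m, Inv s e c m → Sat langOf L Inv Y B (body s) e c m)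
    {a b : Config α H Γ} (h : Sat langOf L Inv Y B a.prog a.eqs a.mqs a.maxCE)
    (hab : Relation.ReflTransGen (Step body langOf L) a b) :
    Sat langOf L Inv Y B b.prog b.eqs b.mqs b.maxCE := by
  induction hab with
  | refl => exact h
  | tail _ hs ih => exact ih.step hbody hs

theorem Sat.progress {a : Config α H Γ} (h : Sat langOf L Inv Y B a.prog a.eqs a.mqs a.maxCE) :
    (∃ q, a.prog = .halt q) ∨ ∃ b, Step body langOf L a b := by
  obtain ⟨p, e, c, m⟩ := a
  cases p with
  | mq x k => exact .inr ⟨_, .mq x k e c m⟩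
  | eq q yes no =>
    right
    by_cases hq : langOf q = L
    · exact ⟨_, .eq_yes q yes no e c m hq⟩
    · obtain ⟨x, hx⟩ : ∃ x, ¬ (x ∈ langOf q ↔ x ∈ L) := by
        by_contra! hcon
        exact hq (Set.ext hcon)
      exact ⟨_, .eq_no q yes no e c m x (by tauto)⟩
  | pick S k =>
    obtain ⟨⟨i, hi⟩, -⟩ := h
    exact .inr ⟨_, .pick S k e c m i hi⟩
  | goto s => exact .inr ⟨_, .goto s e c m⟩
  | halt q => exact .inl ⟨q, rfl⟩

/-- Between two jumps the program is a well-founded tree and structural induction applies; a jump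
lowers the rank and is left to the outer induction. -/
theorem Sat.acc {O : Type*} [Preorder O] [WellFoundedLT O] {rank : Γ → O}
    (hbody : ∀ s e c m, Inv s e c m →
      Sat langOf L (fun s' e c m => Inv s' e c m ∧ rank s' < rank s) Y B (body s) e c m)
    (o : O) (p : Prog α H Γ) (e c m : ℕ)
    (h : Sat langOf L (fun s' e c m => Inv s' e c m ∧ rank s' < o) Y B p e c m) :
    Acc (fun b a => Step body langOf L a b) ⟨p, e, c, m⟩ := by
  induction o using WellFoundedLT.induction generalizing p e c m with
  | _ o iho =>
  induction p generalizing e c m with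
  | mq x k ih =>
    refine ⟨_, ?_⟩
    rintro _ ⟨⟩
    exact ih _ _ _ _ h
  | eq q yes no ihy ihn =>
    refine ⟨_, ?_⟩
    rintro _ (_ | ⟨_, _, _, _, _, _, hq⟩ | ⟨_, _, _, _, _, _, x, hx⟩)
    · exact ihy _ _ _ (h.2.1 hq)
    · exact ihn _ _ _ _ (h.2.2 _ hx)
  | pick S k ih =>
    refine ⟨_, ?_⟩
    intro b hb
    cases hb with
    | pick _ _ _ _ _ i hi => exact ih _ _ _ _ (h.2 i hi)
  | goto s =>
    refine ⟨_, ?_⟩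
    rintro _ ⟨⟩
    exact iho _ h.2.2 _ _ _ _ (hbody _ _ _ _ h.2.1)
  | halt =>
    refine ⟨_, ?_⟩
    rintro _ ⟨⟩

end Soundness

/-! ### Prime sets -/

/-- Primality is carried by a single element that lies in no smaller member. Such witnesses are what
is transported when the table grows and when rows are compared with residuals. -/
theorem mem_Prm_iff {X : Type u} {C : Set (Set X)} {r : Set X} :
    r ∈ Prm C ↔ r ∈ C ∧ ∃ y ∈ r, ∀ k ∈ C, k ⊂ r → y ∉ k := by
  refine and_congr_right fun hr => ?_
  constructor
  · intro h
    by_contra! hcon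
    refine h (Set.Subset.antisymm (fun y hy => ?_) ?_)
    · obtain ⟨k, h1, h2, h3⟩ := hcon y hy
      exact ⟨k, ⟨h1, h2⟩, h3⟩
    · rintro y ⟨k, ⟨-, h2⟩, h3⟩
      exact h2.1 h3
  · rintro ⟨y, hy, h⟩ heq
    rw [heq] at hy
    obtain ⟨k, ⟨h1, h2⟩, h3⟩ := hy
    exact h k h1 h2 h3

/-! ### Correctly filled tables -/

section Tables

variable {α : Type u} (L : Language α)

open Classical in
/-- The observation table for `U` and `V`, correctly filled. -/
noncomputable def tab (U V : Finset (List α)) : Table α :=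
  ⟨U, V, {z | z ∈ Finset.image₂ (· ++ ·) U V ∧ z ∈ L}⟩

variable {L} {U V U' V' : Finset (List α)} {x y z : List α}

theorem tab_U : (tab L U V).U = U := rfl

theorem tab_V : (tab L U V).V = V := rfl

open Classical in
theorem tab_row (hx : x ∈ U) : (tab L U V).row x = tr L V x := by
  ext y
  constructor
  · rintro ⟨h1, -, h2⟩; exact ⟨h1, h2⟩
  · rintro ⟨h1, h2⟩
    exact ⟨h1, Finset.mem_image₂_of_mem hx h1, h2⟩

theorem tab_rows : (tab L U V).rows = tr L V '' U := by
  ext r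
  constructor
  · rintro ⟨x, hx, rfl⟩
    exact ⟨x, hx, (tab_row hx).symm⟩
  · rintro ⟨x, hx, rfl⟩
    exact ⟨x, hx, (tab_row hx).symm⟩

open Classical in
theorem mem_tab_Q : x ∈ (tab L U V).Q ↔ x ∈ U ∧ tr L V x ∈ Prm (tr L V '' U) := by
  unfold Table.Q
  rw [Finset.mem_filter, tab_rows]
  exact and_congr_right fun (hx : x ∈ U) => by rw [tab_row hx]

theorem tab_Q_sub (hx : x ∈ (tab L U V).Q) : x ∈ U := (mem_tab_Q.1 hx).1

open Classical in
theorem mem_tab_Q₀ (h0 : [] ∈ U) :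
    x ∈ (tab L U V).Q₀ ↔ x ∈ (tab L U V).Q ∧ tr L V x ⊆ tr L V [] := by
  unfold Table.Q₀
  rw [Finset.mem_filter]
  exact and_congr_right fun hx => by rw [tab_row (tab_Q_sub hx), tab_row h0]

open Classical in
theorem mem_tab_F (h0 : [] ∈ V) : x ∈ (tab L U V).F ↔ x ∈ (tab L U V).Q ∧ x ∈ L := by
  unfold Table.F
  rw [Finset.mem_filter]
  exact and_congr_right fun hx => by simp [tab_row (tab_Q_sub hx), tr, h0]

theorem tr_mono_V (hV : V ⊆ V') (h : tr L V' x ⊆ tr L V' y) : tr L V x ⊆ tr L V y :=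
  fun _ hz => ⟨hz.1, (h ⟨hV hz.1, hz.2⟩).2⟩

theorem tr_eq_mono_V (hV : V ⊆ V') (h : tr L V' x = tr L V' y) : tr L V x = tr L V y :=
  (tr_mono_V hV h.subset).antisymm (tr_mono_V hV h.superset)

variable (L) in
/-- The number of the non-inclusions between residual languages of `L` that are witnessed in `V`. -/
noncomputable def splits (V : Finset (List α)) : ℕ :=
  {p : Language α × Language α | (p.1 ∈ Res L ∧ p.2 ∈ Res L) ∧
    ∃ y ∈ V, y ∈ p.1 ∧ y ∉ p.2}.ncard

theorem splits_finite (hL : (Res L).Finite) (V : Finset (List α)) :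
    {p : Language α × Language α | (p.1 ∈ Res L ∧ p.2 ∈ Res L) ∧
      ∃ y ∈ V, y ∈ p.1 ∧ y ∉ p.2}.Finite :=
  (hL.prod hL).subset fun _ h => h.1

theorem splits_mono (hL : (Res L).Finite) (hV : V ⊆ V') : splits L V ≤ splits L V' :=
  Set.ncard_le_ncard (fun _ ⟨h, y, hy, h'⟩ => ⟨h, y, hV hy, h'⟩) (splits_finite hL V')

theorem splits_le (hL : (Res L).Finite) : splits L V ≤ (Res L).ncard ^ 2 := by
  rw [pow_two, ← Set.ncard_prod]
  exact Set.ncard_le_ncard (fun _ h => h.1) (hL.prod hL)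

theorem splits_lt (hL : (Res L).Finite) (hV : V ⊆ V') (h : tr L V x ⊆ tr L V y)
    (h' : ¬ tr L V' x ⊆ tr L V' y) : splits L V < splits L V' := by
  refine Set.ncard_lt_ncard ?_ (splits_finite hL V')
  refine ⟨fun _ ⟨h, y, hy, h'⟩ => ⟨h, y, hV hy, h'⟩, fun hcon => ?_⟩
  obtain ⟨z, hz, hz'⟩ := Set.not_subset.1 h'
  obtain ⟨-, z', hz'V, hz'x, hz'y⟩ := @hcon (L.leftQuotient x, L.leftQuotient y)
    ⟨⟨⟨x, rfl⟩, ⟨y, rfl⟩⟩, z, hz.1, hz.2, fun hzy => hz' ⟨hz.1, hzy⟩⟩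
  exact hz'y (h ⟨hz'V, hz'x⟩).2

variable (L) in
/-- The measure of the progress in the construction of the table. -/
noncomputable def progress (U V : Finset (List α)) : ℕ :=
  splits L V + ((Res L).ncard + 1) * U.card + (tab L U V).Q.card

variable (L) in
/-- The invariant of the index sets of the table. -/
structure TableInv (U V : Finset (List α)) : Prop where
  nil_U : [] ∈ U
  nil_V : [] ∈ V
  prefix_closed : ∀ x a, x ++ [a] ∈ U → x ∈ U
  inj : Set.InjOn (tr L V) U
  card_V : V.card ≤ progress L U V

/-- Equal residuals have equal rows, so distinct rows come from distinct residuals. -/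
theorem card_U_le (hL : (Res L).Finite) (h : Set.InjOn (tr L V) U) : U.card ≤ (Res L).ncard := by
  rw [← Set.ncard_coe_finset]
  refine Set.ncard_le_ncard_of_injOn L.leftQuotient (fun x _ => ⟨x, rfl⟩) ?_ hL
  intro x hx y hy hxy
  refine h hx hy ?_
  ext z
  have : z ∈ L.leftQuotient x ↔ z ∈ L.leftQuotient y := by rw [hxy]
  exact and_congr_right fun _ => this

theorem card_Q_le_card_U : (tab L U V).Q.card ≤ U.card := Finset.card_le_card fun _ => tab_Q_sub

theorem card_Q_le (hL : (Res L).Finite) (h : Set.InjOn (tr L V) U) :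
    (tab L U V).Q.card ≤ (Res L).ncard := card_Q_le_card_U.trans (card_U_le hL h)

theorem one_le_ncard_Res (hL : (Res L).Finite) : 1 ≤ (Res L).ncard :=
  (Set.ncard_pos hL).2 ⟨_, [], rfl⟩

/-- With `n ≥ 1` residuals the summands are at most `n²`, `(n + 1)n` and `n`. -/
theorem progress_le (hL : (Res L).Finite) (h : Set.InjOn (tr L V) U) :
    progress L U V ≤ 4 * (Res L).ncard ^ 2 := by
  have h1 := splits_le (V := V) hL
  have h2 := card_U_le hL h
  have h3 := card_Q_le hL h
  have h4 := one_le_ncard_Res hL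
  unfold progress
  nlinarith

/-- A witness of primality survives the growth of `V`. A row strictly below it for `V'` is below it
for `V`, and strictly so, since equality would by injectivity mean the same element of `U`. -/
theorem Q_mono (hinj : Set.InjOn (tr L V) U) (hV : V ⊆ V') :
    (tab L U V).Q ⊆ (tab L U V').Q := by
  intro q hq
  rw [mem_tab_Q] at hq ⊢
  refine ⟨hq.1, mem_Prm_iff.2 ⟨Set.mem_image_of_mem _ hq.1, ?_⟩⟩
  obtain ⟨-, y, hy, h⟩ := mem_Prm_iff.1 hq.2
  refine ⟨y, ⟨hV hy.1, hy.2⟩, ?_⟩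
  rintro _ ⟨x, hx, rfl⟩ hlt hyx
  have hsub := tr_mono_V hV hlt.1
  by_cases heq : tr L V x = tr L V q
  · have := hinj hx hq.1 heq
    subst this
    exact hlt.2 subset_rfl
  · exact h _ (Set.mem_image_of_mem _ hx) (hsub.ssubset_of_ne heq) ⟨hy.1, hyx.2⟩

theorem inj_mono (hinj : Set.InjOn (tr L V) U) (hV : V ⊆ V') : Set.InjOn (tr L V') U :=
  fun _ hx _ hy hxy => hinj hx hy (tr_eq_mono_V hV hxy)

theorem progress_lt_of_split (hL : (Res L).Finite) (hinj : Set.InjOn (tr L V) U) (hV : V ⊆ V')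
    (h : tr L V x ⊆ tr L V y) (h' : ¬ tr L V' x ⊆ tr L V' y) :
    progress L U V < progress L U V' := by
  have h1 := splits_lt hL hV h h'
  have h2 := Finset.card_le_card (Q_mono hinj hV)
  unfold progress
  omega

/-- Among the elements of `U` whose row lies below that of `x` and which `y` leads into `L`, take
`z` with minimal row. Once `y` is in `V`, it witnesses that the row of `z` is prime, whereas by `h`
the string `z` was not in `Q` before. -/
theorem progress_lt_of_uncovered (hL : (Res L).Finite) (hinj : Set.InjOn (tr L V) U)
    (hx : x ∈ U) (hxy : x ++ y ∈ L)
    (h : ∀ q ∈ (tab L U V).Q, tr L V q ⊆ tr L V x → q ++ y ∉ L) [DecidableEq (List α)] :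
    progress L U V < progress L U (insert y V) := by
  have hV : V ⊆ insert y V := Finset.subset_insert _ _
  have hfin : ({z | z ∈ U ∧ tr L V z ⊆ tr L V x ∧ z ++ y ∈ L} : Set (List α)).Finite :=
    U.finite_toSet.subset fun _ h => h.1
  obtain ⟨z, hz⟩ := hfin.exists_minimalFor (tr L V) _ ⟨x, hx, subset_rfl, hxy⟩
  obtain ⟨hzU, hzx, hzy⟩ := hz.prop
  have hlt : (tab L U V).Q.card < (tab L U (insert y V)).Q.card := by
    refine Finset.card_lt_card ⟨Q_mono hinj hV, fun hcon => ?_⟩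
    refine h z (hcon (mem_tab_Q.2 ⟨hzU, mem_Prm_iff.2 ⟨Set.mem_image_of_mem _ hzU, y,
      ⟨Finset.mem_insert_self _ _, hzy⟩, ?_⟩⟩)) hzx hzy
    rintro _ ⟨k, hk, rfl⟩ hkz hyk
    have hsub := tr_mono_V hV hkz.1
    have := hinj hk hzU (hsub.antisymm (hz.le_of_le ⟨hk, hsub.trans hzx, hyk.2⟩ hsub))
    subst this
    exact hkz.2 subset_rfl
  have h1 := splits_mono hL hV
  unfold progress
  omega

/-- A new row may destroy the primality of old ones, but `Q` loses at most `n` elements; this is why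
`U` has weight `n + 1`. -/
theorem progress_lt_of_new_row (hL : (Res L).Finite) (hinj : Set.InjOn (tr L V) U) (hV : V ⊆ V')
    (h : ∀ x ∈ U, tr L V' x ≠ tr L V' z) [DecidableEq (List α)] :
    Set.InjOn (tr L V') ↑(insert z U) ∧ progress L U V < progress L (insert z U) V' := by
  have hz : z ∉ U := fun hz => h z hz rfl
  constructor
  · rw [Finset.coe_insert, Set.injOn_insert (by simpa using hz)]
    refine ⟨inj_mono hinj hV, ?_⟩
    rintro ⟨x, hx, heq⟩
    exact h x hx heq
  · have h1 := splits_mono hL hV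
    have h2 := card_Q_le hL hinj
    unfold progress
    rw [Finset.card_insert_of_notMem hz]
    nlinarith

theorem TableInv.insert_V (hT : TableInv L U V) [DecidableEq (List α)]
    (h : progress L U V < progress L U (insert y V)) : TableInv L U (insert y V) where
  nil_U := hT.nil_U
  nil_V := Finset.mem_insert_of_mem hT.nil_V
  prefix_closed := hT.prefix_closed
  inj := inj_mono hT.inj (Finset.subset_insert _ _)
  card_V := (Finset.card_insert_le _ _).trans (by have := hT.card_V; omega)

theorem TableInv.insert_U (hT : TableInv L U V) (hx : x ∈ U) {a : α} [DecidableEq (List α)]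
    (hV : V ⊆ V') (hcard : V'.card ≤ V.card + 1)
    (hinj : Set.InjOn (tr L V') ↑(insert (x ++ [a]) U))
    (h : progress L U V < progress L (insert (x ++ [a]) U) V') :
    TableInv L (insert (x ++ [a]) U) V' where
  nil_U := Finset.mem_insert_of_mem hT.nil_U
  nil_V := hV hT.nil_V
  prefix_closed y b hy := by
    rw [Finset.mem_insert] at hy
    refine Finset.mem_insert_of_mem ?_
    rcases hy with hy | hy
    · rw [(List.append_inj' hy rfl).1]; exact hx
    · exact hT.prefix_closed _ _ hy
  inj := hinj
  card_V := hcard.trans (by have := hT.card_V; omega)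

theorem tableInv_init (hL : (Res L).Finite) : TableInv L {[]} {[]} where
  nil_U := by simp
  nil_V := by simp
  prefix_closed := by simp
  inj := by simp
  card_V := by
    have := one_le_ncard_Res hL
    simp [progress]; omega

end Tables

/-! ### Symbolic finite automata -/

namespace SFA

variable {α : Type u} {Ψ : Type v} {A : PredAlg α Ψ} {S : Type w} {M : SFA A S} {q r : S} {a : α}
  {x y : List α}

theorem mem_δs_append : r ∈ M.δs q (x ++ y) ↔ ∃ p ∈ M.δs q x, r ∈ M.δs p y := by
  induction x generalizing q with
  | nil => simp [δs]
  | cons a x ih =>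
    simp only [List.cons_append, δs, Set.mem_ofPred_eq, ih]
    constructor
    · rintro ⟨p, hp, p', hp', h⟩; exact ⟨p', ⟨p, hp, hp'⟩, h⟩
    · rintro ⟨p', ⟨p, hp, hp'⟩, h⟩; exact ⟨p, hp, p', hp', h⟩

theorem δ_sub_states (h : r ∈ M.δ q a) : q ∈ M.states ∧ r ∈ M.states := by
  obtain ⟨φ, h, -⟩ := h
  exact M.trans_sub _ h

theorem mem_reach_nil : r ∈ M.reach [] ↔ r ∈ M.start := by
  simp [reach, δs]

theorem mem_reach_append_singleton : r ∈ M.reach (x ++ [a]) ↔ ∃ p ∈ M.reach x, r ∈ M.δ p a := by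
  simp only [reach, Set.mem_ofPred_eq, mem_δs_append]
  constructor
  · rintro ⟨q, hq, p, hp, p', hp', h⟩
    rw [δs, Set.mem_singleton_iff] at h
    subst h
    exact ⟨p, ⟨q, hq, hp⟩, hp'⟩
  · rintro ⟨p, ⟨q, hq, hp⟩, h⟩
    exact ⟨q, hq, p, hp, r, h, rfl⟩

theorem reach_sub_states (h : r ∈ M.reach x) : r ∈ M.states := by
  induction x using List.reverseRecOn with
  | nil => exact M.start_sub (mem_reach_nil.1 h)
  | append_singleton x a _ =>
    obtain ⟨p, -, h⟩ := mem_reach_append_singleton.1 h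
    exact (δ_sub_states h).2

theorem nil_mem_langFrom : [] ∈ M.langFrom q ↔ q ∈ M.final := by
  change (∃ r ∈ ({q} : Set S), r ∈ M.final) ↔ _
  simp

theorem cons_mem_langFrom : a :: x ∈ M.langFrom q ↔ ∃ p ∈ M.δ q a, x ∈ M.langFrom p := by
  constructor
  · rintro ⟨r, ⟨p, hp, hr⟩, hf⟩; exact ⟨p, hp, r, hr, hf⟩
  · rintro ⟨p, hp, r, hr, hf⟩; exact ⟨r, ⟨p, hp, hr⟩, hf⟩

theorem append_mem_lang : x ++ y ∈ M.lang ↔ ∃ q ∈ M.reach x, y ∈ M.langFrom q := by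
  constructor
  · rintro ⟨q, hq, r, hr, hf⟩
    obtain ⟨p, hp, hr⟩ := mem_δs_append.1 hr
    exact ⟨p, ⟨q, hq, hp⟩, r, hr, hf⟩
  · rintro ⟨p, ⟨q, hq, hp⟩, r, hr, hf⟩
    exact ⟨q, hq, r, mem_δs_append.2 ⟨p, hp, hr⟩, hf⟩

/-- A residual is determined by the set of states that are reached. -/
theorem finite_Res (M : SFA A S) : (Res M.lang).Finite := by
  refine ((M.states.finite_toSet.finite_subsets).image
    fun P => ({y | ∃ q ∈ P, y ∈ M.langFrom q} : Language α)).subset ?_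
  rintro _ ⟨x, rfl⟩
  exact ⟨M.reach x, fun _ h => reach_sub_states h, Set.ext fun y => append_mem_lang.symm⟩

/-- Letters which satisfy the same predicates of `M` have the same residual languages. -/
theorem leftQuotient_congr {b : α}
    (h : ∀ t ∈ M.trans, a ∈ A.den t.2.1 ↔ b ∈ A.den t.2.1) :
    M.lang.leftQuotient (x ++ [a]) = M.lang.leftQuotient (x ++ [b]) := by
  ext y
  rw [Language.mem_leftQuotient, Language.mem_leftQuotient, append_mem_lang, append_mem_lang]
  have : M.reach (x ++ [a]) = M.reach (x ++ [b]) := by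
    ext r
    rw [mem_reach_append_singleton, mem_reach_append_singleton]
    refine exists_congr fun p => and_congr_right fun _ => exists_congr fun φ =>
      and_congr_right fun ht => h _ ht
  rw [this]

end SFA

/-! ### Predicates for the sets that the instances have to learn -/

section Denotation

variable {α : Type u} {Ψ : Type v} (A : PredAlg α Ψ)

/-- `D` is a union of cells cut out by the finite set `P`. In the induction, the parts of `D` inside
and outside `φ` are first saturated with respect to the other predicates; intersecting with `φ` or
its complement recovers them. -/
theorem exists_den_eq (P : Finset Ψ) (D : Set α)
    (hD : ∀ a b, (∀ φ ∈ P, a ∈ A.den φ ↔ b ∈ A.den φ) → a ∈ D → b ∈ D) : ∃ ψ, A.den ψ = D := by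
  classical
  induction P using Finset.induction_on generalizing D with
  | empty =>
    rcases D.eq_empty_or_nonempty with rfl | ⟨a, ha⟩
    · exact ⟨A.bot, A.den_bot⟩
    · exact ⟨A.top, A.den_top.trans (Set.eq_univ_of_forall fun b => hD a b (by simp) ha).symm⟩
  | insert φ P _ ih =>
    obtain ⟨ψ₁, h₁⟩ := ih {a | ∃ b ∈ D, b ∈ A.den φ ∧ ∀ χ ∈ P, b ∈ A.den χ ↔ a ∈ A.den χ}
      fun a a' h ⟨b, hb, hbφ, hba⟩ => ⟨b, hb, hbφ, fun χ hχ => (hba χ hχ).trans (h χ hχ)⟩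
    obtain ⟨ψ₂, h₂⟩ := ih {a | ∃ b ∈ D, b ∉ A.den φ ∧ ∀ χ ∈ P, b ∈ A.den χ ↔ a ∈ A.den χ}
      fun a a' h ⟨b, hb, hbφ, hba⟩ => ⟨b, hb, hbφ, fun χ hχ => (hba χ hχ).trans (h χ hχ)⟩
    refine ⟨A.or (A.and φ ψ₁) (A.and (A.not φ) ψ₂), ?_⟩
    rw [A.den_or, A.den_and, A.den_and, A.den_not, h₁, h₂]
    ext a
    constructor
    · rintro (⟨ha, b, hb, hbφ, hba⟩ | ⟨ha, b, hb, hbφ, hba⟩)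
      · refine hD b a (fun χ hχ => ?_) hb
        rcases Finset.mem_insert.1 hχ with rfl | hχ
        · exact iff_of_true hbφ ha
        · exact hba χ hχ
      · refine hD b a (fun χ hχ => ?_) hb
        rcases Finset.mem_insert.1 hχ with rfl | hχ
        · exact iff_of_false hbφ ha
        · exact hba χ hχ
    · intro ha
      by_cases haφ : a ∈ A.den φ
      · exact .inl ⟨haφ, a, ha, haφ, fun _ _ => Iff.rfl⟩
      · exact .inr ⟨haφ, a, ha, haφ, fun _ _ => Iff.rfl⟩

variable {A} in
theorem exists_den_of_arising {S : Type w} (M : SFA A S) {D : Set α}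
    (hD : D ∈ arisingSets M.lang) : ∃ ψ, A.den ψ = D := by
  classical
  obtain ⟨_, ⟨x, rfl⟩, C, hC, rfl⟩ := hD
  refine exists_den_eq A (M.trans.image fun t => t.2.1) _ ?_
  rintro a b hab ⟨E, hE, ha⟩
  refine ⟨E, hE, ?_⟩
  obtain ⟨K, -, rfl⟩ := hC hE
  change K = _ at ha ⊢
  rw [ha, ← Language.leftQuotient_append, ← Language.leftQuotient_append]
  exact M.leftQuotient_congr fun t ht => hab _ (Finset.mem_image_of_mem _ ht)

/-- The set that the instance of the predicate learner for the edge from `q` to `q'` has to learn. -/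
def target (L : Language α) (V : Finset (List α)) (q q' : List α) : Set α :=
  {a | tr L V q' ⊆ tr L V (q ++ [a])}

theorem tr_congr {L : Language α} {V : Finset (List α)} {x y : List α}
    (h : L.leftQuotient x = L.leftQuotient y) : tr L V x = tr L V y := by
  ext z
  have : z ∈ L.leftQuotient x ↔ z ∈ L.leftQuotient y := by rw [h]
  exact and_congr_right fun _ => this

/-- Whether `a` belongs to the target depends only on the residual of `qa`, so the target is the
union of the letter classes that it contains. -/
theorem target_mem_arising (L : Language α) (V : Finset (List α)) (q q' : List α) :
    target L V q q' ∈ arisingSets L := by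
  refine ⟨_, ⟨q, rfl⟩, {D | D ∈ letterClasses L (L.leftQuotient q) ∧ D ⊆ target L V q q'},
    fun _ h => h.1, Set.Subset.antisymm ?_ ?_⟩
  · intro a ha
    refine ⟨_, ⟨⟨L.leftQuotient (q ++ [a]), ⟨_, rfl⟩, rfl⟩, ?_⟩, ?_⟩
    · intro b hb
      change _ = _ at hb
      rw [← Language.leftQuotient_append] at hb
      change tr L V q' ⊆ tr L V (q ++ [b])
      rw [← tr_congr hb]
      exact ha
    · change _ = _
      rw [Language.leftQuotient_append]
  · rintro a ⟨D, ⟨-, hD⟩, ha⟩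
    exact hD ha

end Denotation

/-! ### The hypotheses returned -/

section Returned

variable {α : Type u} {Ψ : Type v} {A : PredAlg α Ψ} {M : SFA A (List α)} {L : Language α}
  {U V : Finset (List α)}

/-- Each state `q` is reached by reading the string `q` itself (`hself`). By Condition 1 larger rows
accept more, so with Condition 2 the language of `q` is the residual of `q`. As `M` accepts `L`,
each residual is a union of languages of states, and by Condition 3 a suffix witnessing that a row
is prime also witnesses that the residual is prime. -/
theorem isResidual_isReduced_of_conditions (hT : TableInv L U V) (hM : M.lang = L)
    (hstates : M.states = (tab L U V).Q) (hstart : M.start = (tab L U V).Q₀)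
    (hfinal : M.final = (tab L U V).F)
    (h1 : ∀ q ∈ (tab L U V).Q, ∀ q' ∈ (tab L U V).Q, tr L V q ⊆ tr L V q' →
      ∀ a, M.δ q a ⊆ M.δ q' a)
    (h2 : ∀ x ∈ U, x ≠ [] → ∀ s ∈ M.reach x, tr L V s ⊆ tr L V x)
    (h3 : ∀ y ∈ V, y ≠ [] → ∀ q ∈ (tab L U V).Q, (y ∈ tr L V q ↔ y ∈ M.langFrom q)) :
    M.IsResidual ∧ M.IsReduced := by
  have hnil : ∀ q ∈ (tab L U V).Q, ([] ∈ M.langFrom q ↔ [] ∈ tr L V q) := by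
    intro q hq
    rw [SFA.nil_mem_langFrom, hfinal, mem_tab_F hT.nil_V]
    simp [hq, tr, hT.nil_V]
  have h3' : ∀ y ∈ V, ∀ q ∈ (tab L U V).Q, (y ∈ tr L V q ↔ y ∈ M.langFrom q) := by
    intro y hy q hq
    by_cases hy0 : y = []
    · subst hy0; exact (hnil q hq).symm
    · exact h3 y hy hy0 q hq
  have hmono : ∀ q ∈ (tab L U V).Q, ∀ q' ∈ (tab L U V).Q, tr L V q ⊆ tr L V q' →
      ∀ y, y ∈ M.langFrom q → y ∈ M.langFrom q' := by
    intro q hq q' hq' hsub y hy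
    cases y with
    | nil =>
      rw [hnil q hq] at hy
      rw [hnil q' hq']
      exact hsub hy
    | cons a y =>
      rw [SFA.cons_mem_langFrom] at hy ⊢
      obtain ⟨p, hp, hy⟩ := hy
      exact ⟨p, h1 q hq q' hq' hsub a hp, hy⟩
  have hreach : ∀ x ∈ U, ∀ s ∈ M.reach x, s ∈ (tab L U V).Q ∧ tr L V s ⊆ tr L V x := by
    intro x hx s hs
    refine ⟨hstates ▸ SFA.reach_sub_states hs, ?_⟩
    by_cases hx0 : x = []
    · subst hx0
      rw [SFA.mem_reach_nil, hstart, mem_tab_Q₀ hT.nil_U] at hs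
      exact hs.2
    · exact h2 x hx hx0 s hs
  -- A witness `y` for the primality of the row of `q` is accepted from some `s` reached by `q`. The
  -- row of `s` lies below that of `q` and contains `y`, so the rows coincide and `s = q`.
  have hself : ∀ q ∈ (tab L U V).Q, q ∈ M.reach q := by
    intro q hq
    obtain ⟨hqU, hprm⟩ := mem_tab_Q.1 hq
    obtain ⟨-, y, hy, hlow⟩ := mem_Prm_iff.1 hprm
    have hyL : q ++ y ∈ M.lang := hM ▸ hy.2
    obtain ⟨s, hs, hys⟩ := SFA.append_mem_lang.1 hyL
    obtain ⟨hsQ, hsub⟩ := hreach q hqU s hs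
    have hsU := (mem_tab_Q.1 hsQ).1
    by_cases heq : tr L V s = tr L V q
    · have := hT.inj hsU hqU heq
      subst this
      exact hs
    · exact absurd ((h3' y hy.1 s hsQ).2 hys)
        (hlow _ (Set.mem_image_of_mem _ hsU) (hsub.ssubset_of_ne heq))
  have hlang : ∀ q ∈ (tab L U V).Q, M.langFrom q = L.leftQuotient q := by
    intro q hq
    have hqU := (mem_tab_Q.1 hq).1
    ext y
    rw [Language.mem_leftQuotient, ← hM, SFA.append_mem_lang]
    constructor
    · exact fun hy => ⟨q, hself q hq, hy⟩
    · rintro ⟨s, hs, hy⟩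
      obtain ⟨hsQ, hsub⟩ := hreach q hqU s hs
      exact hmono s hsQ q hq hsub y hy
  have hres : ∀ q ∈ (tab L U V).Q, M.langFrom q ∈ Res M.lang := by
    intro q hq
    rw [hlang q hq, hM]
    exact ⟨q, rfl⟩
  have hunion : ∀ K ∈ Res M.lang, ∀ y ∈ K, ∃ s ∈ (tab L U V).Q, y ∈ M.langFrom s ∧
      M.langFrom s ≤ K := by
    rintro _ ⟨x, rfl⟩ y hy
    obtain ⟨s, hs, hys⟩ := SFA.append_mem_lang.1 hy
    exact ⟨s, hstates ▸ SFA.reach_sub_states hs, hys,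
      fun z hz => SFA.append_mem_lang.2 ⟨s, hs, hz⟩⟩
  have hprime : ∀ q ∈ (tab L U V).Q, M.langFrom q ∈ Prm (Res M.lang) := by
    intro q hq
    obtain ⟨hqU, hprm⟩ := mem_tab_Q.1 hq
    obtain ⟨-, y, hy, hlow⟩ := mem_Prm_iff.1 hprm
    refine mem_Prm_iff.2 ⟨hres q hq, y, (h3' y hy.1 q hq).1 hy, ?_⟩
    intro K hK hlt hyK
    obtain ⟨s, hs, hys, hsK⟩ := hunion K hK y hyK
    have hsU := (mem_tab_Q.1 hs).1
    have hsub : tr L V s ⊆ tr L V q := fun z hz =>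
      (h3' z hz.1 q hq).2 (hlt.1 (hsK ((h3' z hz.1 s hs).1 hz)))
    by_cases heq : tr L V s = tr L V q
    · have := hT.inj hsU hqU heq
      subst this
      exact hlt.2 hsK
    · exact hlow _ (Set.mem_image_of_mem _ hsU) (hsub.ssubset_of_ne heq)
        ((h3' y hy.1 s hs).2 hys)
  refine ⟨fun q hq => hres q (hstates ▸ hq), ?_, fun q hq => hprime q (hstates ▸ hq)⟩
  have himage : M.langFrom '' (tab L U V).Q = Prm (Res M.lang) := by
    refine Set.Subset.antisymm ?_ ?_
    · rintro _ ⟨q, hq, rfl⟩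
      exact hprime q hq
    -- A state whose language lies below `K` and contains a witness of the primality of `K` must
    -- have the language `K`.
    · intro K hK
      obtain ⟨hKR, y, hy, hlow⟩ := mem_Prm_iff.1 hK
      obtain ⟨s, hs, hys, hsK⟩ := hunion K hKR y hy
      refine ⟨s, hs, ?_⟩
      by_contra hne
      exact hlow _ (hres s hs) (Set.ssubset_iff_subset_ne.2 ⟨hsK, hne⟩) hys
  have hinj : Set.InjOn M.langFrom (tab L U V).Q := by
    intro q hq q' hq' heq
    refine hT.inj (mem_tab_Q.1 hq).1 (mem_tab_Q.1 hq').1 ?_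
    ext y
    constructor
    · intro hy
      have := (h3' y hy.1 q hq).1 hy
      rw [heq] at this
      exact (h3' y hy.1 q' hq').2 this
    · intro hy
      have := (h3' y hy.1 q' hq').1 hy
      rw [← heq] at this
      exact (h3' y hy.1 q hq).2 this
  exact (congrArg Finset.card hstates).trans ((Set.ncard_coe_finset _).symm.trans
    (hinj.ncard_image.symm.trans (congrArg Set.ncard himage)))

end Returned

/-! ### Interactions with a predicate learner -/

section Interactions

variable {α : Type u} {Ψ : Type v} (A : PredAlg α Ψ) (Λ : PredLearner α Ψ) {D : Set α}

/-- `h'` continues `h` by one answer of a teacher for `D`. -/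
def Continues (D : Set α) (h' h : List (Answer α)) : Prop :=
  (∃ r, h' = r :: h) ∧ Interaction A Λ D h'

variable {A Λ}

/-- `Learns` excludes infinite descent from the empty interaction, and accessibility is inherited by
all its continuations. -/
theorem Interaction.acc (hD : Learns A Λ D) {h : List (Answer α)} (hh : Interaction A Λ D h) :
    Acc (Continues A Λ D) h := by
  have h0 : Acc (Continues A Λ D) [] := by
    by_contra hcon
    obtain ⟨f, hf0, hf⟩ := not_acc_iff_exists_descending_chain.1 hcon
    refine hD ⟨f, hf0, fun i => ⟨?_, (hf i).1⟩⟩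
    cases i with
    | zero => rw [hf0]; exact .nil
    | succ i => exact (hf i).2
  induction hh with
  | nil => exact h0
  | mq hh hq ih => exact ih.inv ⟨⟨_, rfl⟩, .mq hh hq⟩
  | ce hh hq ha ih => exact ih.inv ⟨⟨_, rfl⟩, .ce hh hq ha⟩

theorem isWellFounded_continues (hD : Learns A Λ D) : IsWellFounded _ (Continues A Λ D) := by
  refine ⟨⟨fun h => ⟨_, fun h' hh' => ?_⟩⟩⟩
  exact hh'.2.acc hD

variable (A Λ D) in
open Classical in
/-- The ordinal rank of an interaction of a learner with the teachers for `D`. -/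
noncomputable def interactionRank (h : List (Answer α)) : Ordinal.{u} :=
  if hD : Learns A Λ D then
    haveI := isWellFounded_continues hD
    IsWellFounded.rank (Continues A Λ D) h
  else 0

/-- Counterexamples may branch infinitely, so termination alone yields an ordinal and not a number.
-/
theorem interactionRank_lt (hD : Learns A Λ D) {h : List (Answer α)} {r : Answer α}
    (hh : Interaction A Λ D (r :: h)) :
    interactionRank A Λ D (r :: h) < interactionRank A Λ D h := by
  have := isWellFounded_continues hD
  simp only [interactionRank, hD, dif_pos]
  exact IsWellFounded.rank_lt_of_rel ⟨⟨r, rfl⟩, hh⟩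

/-- The number of the counterexamples in `h`. -/
def numCE (h : List (Answer α)) : ℕ :=
  h.countP (fun r => match r with | .mq _ => false | .ce _ => true)

/-- The number of the answers to membership queries in `h`. -/
def numAns (h : List (Answer α)) : ℕ :=
  h.countP (fun r => match r with | .mq _ => true | .ce _ => false)

theorem Interaction.numCE_le {L : Language α} (hD : D ∈ arisingSets L) {h : List (Answer α)}
    (hh : Interaction A Λ D h) {E : ℕ} (hE : maxEQ A Λ L ≤ E) : numCE h ≤ E := by
  have h1 : (numEQ Λ h : ℕ∞) ≤ maxEQ A Λ L :=
    (le_iSup₂ (f := fun h (_ : Interaction A Λ D h) => (numEQ Λ h : ℕ∞)) h hh).trans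
      (le_iSup₂ (f := fun D (_ : D ∈ arisingSets L) => costEQ A Λ D) D hD)
  exact (Nat.le_add_right _ _).trans (Nat.cast_le.1 (h1.trans hE))

theorem Interaction.numAns_le {L : Language α} (hD : D ∈ arisingSets L) {h : List (Answer α)}
    (hh : Interaction A Λ D h) {K : ℕ} (hK : maxMQ A Λ L ≤ K) : numAns h ≤ K := by
  have h1 : (numMQ Λ h : ℕ∞) ≤ maxMQ A Λ L :=
    (le_iSup₂ (f := fun h (_ : Interaction A Λ D h) => (numMQ Λ h : ℕ∞)) h hh).trans
      (le_iSup₂ (f := fun D (_ : D ∈ arisingSets L) => costMQ A Λ D) D hD)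
  exact (Nat.le_add_right _ _).trans (Nat.cast_le.1 (h1.trans hK))

end Interactions

theorem give_self {α : Type u} (h : Hist α) (q q' : List α) (r : Answer α) :
    h.give q q' r q q' = r :: h q q' := by simp [Hist.give]

theorem give_of_ne {α : Type u} (h : Hist α) {q q' x y : List α} (r : Answer α)
    (hne : (x, y) ≠ (q, q')) : h.give q q' r x y = h x y := by
  unfold Hist.give
  rw [if_neg]
  rintro ⟨rfl, rfl⟩
  exact hne rfl

theorem exists_sum_give {α : Type u} {s : Finset (List α × List α)} {q q' : List α}
    (hq : (q, q') ∈ s) (h : Hist α) (r : Answer α) (f : List (Answer α) → ℕ) :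
    ∃ n, ∑ p ∈ s, f (h p.1 p.2) = f (h q q') + n ∧
      ∑ p ∈ s, f (h.give q q' r p.1 p.2) = f (r :: h q q') + n := by
  classical
  refine ⟨∑ p ∈ s.erase (q, q'), f (h p.1 p.2), (Finset.add_sum_erase s _ hq).symm, ?_⟩
  rw [← Finset.add_sum_erase s _ hq, give_self]
  congr 1
  exact Finset.sum_congr rfl fun p hp => by rw [give_of_ne h r (Finset.ne_of_mem_erase hp)]

/-! ### Bounds and ranks -/

section Bounds

variable {α : Type u} {Ψ : Type v} (A : PredAlg α Ψ) (Λ : PredLearner α Ψ) (L : Language α)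

/-- The pairs of states of the hypothesis. -/
noncomputable def pairs (U V : Finset (List α)) : Finset (List α × List α) :=
  (tab L U V).Q ×ˢ (tab L U V).Q

/-- A bound on the number of membership queries between two jumps of the learner, apart from those
which fill the table. -/
def roundBound (n m : ℕ) : ℕ := 8 * n ^ 2 + 3 * n + 1 + n * Nat.clog 2 (m + 4 * n ^ 2)

/-- A bound on the number of membership queries between two extensions of the table, apart from
those which fill the table. -/
def phaseBound (n E K m : ℕ) : ℕ :=
  n ^ 2 * (K * (4 * n ^ 2)) + n ^ 2 * (E * roundBound n m) + roundBound n m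

theorem roundBound_mono {n m m' : ℕ} (h : m ≤ m') : roundBound n m ≤ roundBound n m' := by
  unfold roundBound
  have := Nat.clog_mono_right 2 (show m + 4 * n ^ 2 ≤ m' + 4 * n ^ 2 by omega)
  gcongr

theorem phaseBound_mono {n E K m m' : ℕ} (h : m ≤ m') :
    phaseBound n E K m ≤ phaseBound n E K m' := by
  unfold phaseBound
  have := roundBound_mono (n := n) h
  gcongr

/-- The bound on the number of equivalence queries raised up to the state `U`, `V`, `h` of the
learner. -/
noncomputable def eqBound (U V : Finset (List α)) (h : Hist α) (E : ℕ) : ℕ :=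
  progress L U V * (1 + (Res L).ncard ^ 2 * E) + ∑ p ∈ pairs L U V, numCE (h p.1 p.2)

open Classical in
/-- The bound on the number of membership queries raised up to the state `U`, `V`, `h` of the
learner. -/
noncomputable def mqBound (U V : Finset (List α)) (h : Hist α) (E K m : ℕ) : ℕ :=
  (Finset.image₂ (· ++ ·) U V).card + progress L U V * phaseBound (Res L).ncard E K m +
    (∑ p ∈ pairs L U V, numAns (h p.1 p.2)) * (4 * (Res L).ncard ^ 2) +
    (∑ p ∈ pairs L U V, numCE (h p.1 p.2)) * roundBound (Res L).ncard m

/-- The invariant of the learner, with slack `xe`, `xc` in the bounds on the numbers of queries. -/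
structure State (E K : ℕ) (U V : Finset (List α)) (h : Hist α) (e c m xe xc : ℕ) : Prop where
  table : TableInv L U V
  len : ∀ y ∈ V, y.length ≤ m + progress L U V
  valid : ∀ q q', Interaction A Λ (target L V q q') (h q q')
  eqs : maxEQ A Λ L ≤ E → e ≤ eqBound L U V h E + xe
  mqs : maxEQ A Λ L ≤ E → maxMQ A Λ L ≤ K → c ≤ mqBound L U V h E K m + xc

/-- The bounds on the numbers of queries, in a form which is independent of the table. -/
def Bounded (E K e c m : ℕ) : Prop :=
  (maxEQ A Λ L ≤ E → e ≤ (4 * (Res L).ncard ^ 2 + 1) * (1 + (Res L).ncard ^ 2 * E)) ∧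
  (maxEQ A Λ L ≤ E → maxMQ A Λ L ≤ K → c ≤ 4 * (Res L).ncard ^ 3 +
    (4 * (Res L).ncard ^ 2 + 1) * phaseBound (Res L).ncard E K m)

/-- The remaining ranks of all instances of the predicate learner. -/
noncomputable def histRank (U V : Finset (List α)) (h : Hist α) : List α × List α →₀ Ordinal.{u} :=
  letI := Classical.decEq (List α × List α)
  Finsupp.onFinset (pairs L U V)
    (fun p => if p ∈ pairs L U V then interactionRank A Λ (target L V p.1 p.2) (h p.1 p.2) else 0)
    (by intro p hp; by_contra hcon; simp [hcon] at hp)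

/-- The type of the ranks of control points. -/
abbrev CtrlRank (α : Type u) := ℕ ×ₗ ((List α × List α →₀ Ordinal.{u}) ×ₗ ℕ)

/-- The rank of a state of the learner. -/
noncomputable def stateRank (U V : Finset (List α)) (h : Hist α) (k : ℕ) : CtrlRank α :=
  toLex (2 * (4 * (Res L).ncard ^ 2 - progress L U V), toLex (histRank A Λ L U V h, k))

/-- The rank of a control point. -/
noncomputable def ctrlRank : Ctrl α → CtrlRank α
  | .build T => toLex (2 * (4 * (Res L).ncard ^ 2 - progress L T.U T.V) + 1, toLex (0, 0))
  | .update T h _ _ todo => stateRank A Λ L T.U T.V h (todo.card + 1)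
  | .confirm T h => stateRank A Λ L T.U T.V h 0

/-- The invariant of the learner at its control points. -/
def Inv (E K : ℕ) : Ctrl α → ℕ → ℕ → ℕ → Prop
  | .build T, e, c, m => ∃ U V, T = tab L U V ∧ State A Λ L E K U V (fun _ _ => []) e c m 0 0
  | .update T h q q' todo, e, c, m => ∃ U V, T = tab L U V ∧ State A Λ L E K U V h e c m 0 0 ∧
      (q, q') ∈ pairs L U V ∧ todo ⊆ pairs L U V ∧
      ∀ p ∈ pairs L U V, p ≠ (q, q') → p ∉ todo → ∃ φ, Λ (h p.1 p.2) = .eq φ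
  | .confirm T h, e, c, m => ∃ U V, T = tab L U V ∧ State A Λ L E K U V h e c m 0 0 ∧
      ∀ p ∈ pairs L U V, ∃ φ, Λ (h p.1 p.2) = .eq φ

/-- The jumps to control points which satisfy the invariant and are of rank less than `o`. -/
def Below (E K : ℕ) (o : CtrlRank α) (s : Ctrl α) (e c m : ℕ) : Prop :=
  Inv A Λ L E K s e c m ∧ ctrlRank A Λ L s < o

variable {A Λ L} {E K : ℕ} {U V U' V' : Finset (List α)} {h : Hist α} {e c m xe xc : ℕ}

/-- One coordinate falls and the others stay. Finitely supported families of ordinals are well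
founded pointwise, so the ranks need not be added up. -/
theorem histRank_give (hlearn : ∀ D ∈ arisingSets L, Learns A Λ D) {q q' : List α}
    {r : Answer α} (hq : (q, q') ∈ pairs L U V)
    (hh : Interaction A Λ (target L V q q') (r :: h q q')) :
    histRank A Λ L U V (h.give q q' r) < histRank A Λ L U V h := by
  have key : interactionRank A Λ (target L V q q') (h.give q q' r q q') <
      interactionRank A Λ (target L V q q') (h q q') := by
    rw [give_self]
    exact interactionRank_lt (hlearn _ (target_mem_arising L V q q')) hh
  refine Finsupp.lt_def.2 ⟨fun p => ?_, (q, q'), ?_⟩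
  · simp only [histRank, Finsupp.onFinset_apply]
    split_ifs
    · by_cases hp : p = (q, q')
      · subst hp; exact key.le
      · rw [give_of_ne h r hp]
    · exact le_rfl
  · simp only [histRank, Finsupp.onFinset_apply, if_pos hq]
    exact key

theorem card_pairs_le (hL : (Res L).Finite) (hT : TableInv L U V) :
    (pairs L U V).card ≤ (Res L).ncard ^ 2 := by
  have := card_Q_le hL hT.inj
  rw [pairs, Finset.card_product]
  nlinarith

theorem State.mono {e' c' xe' xc' : ℕ} (hS : State A Λ L E K U V h e c m xe xc)
    (he : e' + xe ≤ e + xe') (hc : c' + xc ≤ c + xc') :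
    State A Λ L E K U V h e' c' m xe' xc' where
  table := hS.table
  len := hS.len
  valid := hS.valid
  eqs hE := by have := hS.eqs hE; omega
  mqs hE hK := by have := hS.mqs hE hK; omega

theorem State.mono_maxCE {m' : ℕ} (hS : State A Λ L E K U V h e c m xe xc) (hm : m ≤ m') :
    State A Λ L E K U V h e c m' xe xc where
  table := hS.table
  len y hy := (hS.len y hy).trans (by omega)
  valid := hS.valid
  eqs := hS.eqs
  mqs hE hK := by
    refine (hS.mqs hE hK).trans ?_
    unfold mqBound
    have h1 := phaseBound_mono (n := (Res L).ncard) (E := E) (K := K) hm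
    have h2 := roundBound_mono (n := (Res L).ncard) hm
    gcongr

theorem State.sum_numCE_le (hL : (Res L).Finite) (hS : State A Λ L E K U V h e c m xe xc)
    (hE : maxEQ A Λ L ≤ E) :
    ∑ p ∈ pairs L U V, numCE (h p.1 p.2) ≤ (Res L).ncard ^ 2 * E := by
  refine (Finset.sum_le_card_nsmul _ _ E fun p _ =>
    (hS.valid p.1 p.2).numCE_le (target_mem_arising L V _ _) hE).trans ?_
  exact Nat.mul_le_mul_right _ (card_pairs_le hL hS.table)

theorem State.sum_numAns_le (hL : (Res L).Finite) (hS : State A Λ L E K U V h e c m xe xc)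
    (hK : maxMQ A Λ L ≤ K) :
    ∑ p ∈ pairs L U V, numAns (h p.1 p.2) ≤ (Res L).ncard ^ 2 * K := by
  refine (Finset.sum_le_card_nsmul _ _ K fun p _ =>
    (hS.valid p.1 p.2).numAns_le (target_mem_arising L V _ _) hK).trans ?_
  exact Nat.mul_le_mul_right _ (card_pairs_le hL hS.table)

open Classical in
-- The instances for the current table cost at most the first two summands of `phaseBound`; the
-- third covers the round in progress. One further unit of potential thus pays for all that was
-- spent on this table.
theorem State.mqBound_le (hL : (Res L).Finite) (hS : State A Λ L E K U V h e c m xe xc)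
    (hE : maxEQ A Λ L ≤ E) (hK : maxMQ A Λ L ≤ K) :
    mqBound L U V h E K m + roundBound (Res L).ncard m ≤
      (Finset.image₂ (· ++ ·) U V).card +
        (progress L U V + 1) * phaseBound (Res L).ncard E K m := by
  have h1 := Nat.mul_le_mul_right (4 * (Res L).ncard ^ 2) (hS.sum_numAns_le hL hK)
  have h2 := Nat.mul_le_mul_right (roundBound (Res L).ncard m) (hS.sum_numCE_le hL hE)
  rw [mul_assoc] at h1 h2
  unfold mqBound
  rw [add_mul, one_mul]
  have : phaseBound (Res L).ncard E K m = (Res L).ncard ^ 2 * (K * (4 * (Res L).ncard ^ 2)) +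
    (Res L).ncard ^ 2 * (E * roundBound (Res L).ncard m) + roundBound (Res L).ncard m := rfl
  omega

/-- The slack stands for one unfinished round: an EQ and at most `roundBound` MQs that are not yet
charged to an extension or a counterexample. -/
theorem State.bounded (hL : (Res L).Finite)
    (hS : State A Λ L E K U V h e c m 1 (roundBound (Res L).ncard m)) :
    Bounded A Λ L E K e c m := by
  classical
  have hp := progress_le hL hS.table.inj
  constructor
  · intro hE
    have h1 := hS.eqs hE
    have h2 := hS.sum_numCE_le hL hE
    have h3 := Nat.mul_le_mul_right (1 + (Res L).ncard ^ 2 * E) hp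
    unfold eqBound at h1
    rw [add_mul, one_mul]
    omega
  · intro hE hK
    refine (hS.mqs hE hK).trans ((hS.mqBound_le hL hE hK).trans ?_)
    have h1 : (Finset.image₂ (· ++ ·) U V).card ≤ 4 * (Res L).ncard ^ 3 := by
      refine (Finset.card_image₂_le _ _ _).trans ?_
      calc U.card * V.card ≤ (Res L).ncard * (4 * (Res L).ncard ^ 2) :=
            Nat.mul_le_mul (card_U_le hL hS.table.inj) (hS.table.card_V.trans hp)
        _ = _ := by ring
    gcongr

theorem Bounded.antitone {c' : ℕ} (hc : c' ≤ c) (hb : Bounded A Λ L E K e c m) :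
    Bounded A Λ L E K e c' m :=
  ⟨hb.1, fun hE hK => hc.trans (hb.2 hE hK)⟩

theorem Below.antitone {o : CtrlRank α} {s : Ctrl α} {c' : ℕ} (hc : c' ≤ c)
    (hs : Below A Λ L E K o s e c m) : Below A Λ L E K o s e c' m := by
  refine ⟨?_, hs.2⟩
  have hi := hs.1
  cases s with
  | build T =>
    obtain ⟨U, V, hT, hS⟩ := hi
    exact ⟨U, V, hT, hS.mono le_rfl (by omega)⟩
  | update T h q q' todo =>
    obtain ⟨U, V, hT, hS, hrest⟩ := hi
    exact ⟨U, V, hT, hS.mono le_rfl (by omega), hrest⟩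
  | confirm T h =>
    obtain ⟨U, V, hT, hS, hrest⟩ := hi
    exact ⟨U, V, hT, hS.mono le_rfl (by omega), hrest⟩

end Bounds

/-! ### The parts of the learner -/

section Parts

variable {α : Type u} {Ψ : Type v} {A : PredAlg α Ψ} {Λ : PredLearner α Ψ} {L : Language α}
  {E K : ℕ} {o : CtrlRank α} {U V U' V' : Finset (List α)} {h : Hist α} {e c m xe xc : ℕ}

variable (A L) in
/-- What the returned hypotheses satisfy. -/
def Correct (M : SFA A (List α)) : Prop := M.IsResidual ∧ M.IsReduced ∧ M.lang = L

variable (A Λ L E K) in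
/-- The program logic for the learner. -/
abbrev LSat (o : CtrlRank α) : LProg A → ℕ → ℕ → ℕ → Prop :=
  Sat SFA.lang L (Below A Λ L E K o) (Correct A L) (Bounded A Λ L E K)

theorem LSat.antitone {p : LProg A} (hp : LSat A Λ L E K o p e c m) {c' : ℕ} (hc : c' ≤ c) :
    LSat A Λ L E K o p e c' m :=
  Sat.antitone (fun _ _ _ _ h h' => h'.antitone h) (fun _ _ _ _ _ h h' => h'.antitone h) hp hc

open Classical in
-- The old table is not assumed to satisfy the invariant, because the learner starts from the empty
-- one.
theorem sat_extend_of_build (hU : U ⊆ U') (hV : V ⊆ V')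
    (hb : Bounded A Λ L E K e (c + ((Finset.image₂ (· ++ ·) U' V').card -
      (Finset.image₂ (· ++ ·) U V).card)) m)
    (hG : Below A Λ L E K o (.build (tab L U' V')) e (c + ((Finset.image₂ (· ++ ·) U' V').card -
      (Finset.image₂ (· ++ ·) U V).card)) m) :
    LSat A Λ L E K o (extend A (tab L U V) U' V') e c m := by
  apply sat_askSet
  have hsub : Finset.image₂ (· ++ ·) U V ⊆ Finset.image₂ (· ++ ·) U' V' :=
    Finset.image₂_subset hU hV
  rw [Finset.length_toList, Finset.card_sdiff_of_subset (by exact hsub)]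
  have htab : (⟨U', V', (tab L U V).pos ∪ {x | x ∈ (Finset.image₂ (· ++ ·) U' V' \
      Finset.image₂ (· ++ ·) (tab L U V).U (tab L U V).V).toList ∧ x ∈ L}⟩ : Table α) =
      tab L U' V' := by
    unfold tab
    congr 1
    ext z
    simp only [Set.mem_union, Set.mem_ofPred_eq, Finset.mem_toList, Finset.mem_sdiff]
    constructor
    · rintro (⟨h1, h2⟩ | ⟨⟨h1, -⟩, h2⟩)
      · exact ⟨hsub h1, h2⟩
      · exact ⟨h1, h2⟩
    · rintro ⟨h1, h2⟩
      by_cases hz : z ∈ Finset.image₂ (· ++ ·) U V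
      · exact .inl ⟨hz, h2⟩
      · exact .inr ⟨⟨h1, hz⟩, h2⟩
  rw [htab]
  exact ⟨hb, hG⟩

/-- The gain in potential pays for the old histories, which are discarded, and for the slack; new
entries are paid for by the size of `U'V'`. A suffix longer by one is allowed by `hlen` for the same
reason. -/
theorem State.sat_extend (hL : (Res L).Finite)
    (hS : State A Λ L E K U V h e c m 1 (roundBound (Res L).ncard m))
    (ho : toLex (2 * (4 * (Res L).ncard ^ 2 - progress L U V), toLex (0, 0)) ≤ o)
    (hT : TableInv L U' V') (hU : U ⊆ U') (hV : V ⊆ V')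
    (hlt : progress L U V < progress L U' V')
    (hlen : ∀ y ∈ V', y.length ≤ m + progress L U V + 1) :
    LSat A Λ L E K o (extend A (tab L U V) U' V') e c m := by
  classical
  have hcard : (Finset.image₂ (· ++ ·) U V).card ≤ (Finset.image₂ (· ++ ·) U' V').card :=
    Finset.card_le_card (Finset.image₂_subset hU hV)
  have hS' : State A Λ L E K U' V' (fun _ _ => []) e
      (c + ((Finset.image₂ (· ++ ·) U' V').card - (Finset.image₂ (· ++ ·) U V).card)) m 0 0 := by
    refine ⟨hT, fun y hy => (hlen y hy).trans (by omega), fun _ _ => .nil, ?_, ?_⟩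
    · intro hE
      have h1 := hS.eqs hE
      have h2 := hS.sum_numCE_le hL hE
      have h3 := Nat.mul_le_mul_right (1 + (Res L).ncard ^ 2 * E) (Nat.succ_le_of_lt hlt)
      unfold eqBound at h1 ⊢
      rw [Nat.succ_mul] at h3
      omega
    · intro hE hK
      have h1 := hS.mqs hE hK
      have h2 := hS.mqBound_le hL hE hK
      have h3 := Nat.mul_le_mul_right (phaseBound (Res L).ncard E K m) (Nat.succ_le_of_lt hlt)
      have h4 : (Finset.image₂ (· ++ ·) U' V').card +
        progress L U' V' * phaseBound (Res L).ncard E K m ≤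
          mqBound L U' V' (fun _ _ => []) E K m := by
        unfold mqBound
        omega
      simp only [Nat.succ_eq_add_one] at h3
      omega
  refine sat_extend_of_build hU hV ?_ ⟨⟨U', V', rfl, hS'⟩, lt_of_lt_of_le ?_ ho⟩
  · exact (hS'.mono (by omega) (by omega)).bounded hL
  -- The potential is at most `4n²`, so the truncated difference really drops; its doubling leaves
  -- room for the extra one in the rank of `build`.
  · have := progress_le hL hT.inj
    exact Prod.Lex.toLex_lt_toLex.2 (.inl (by simp only [tab]; omega))

/-- The additional counterexample in the sums absorbs the slack of a whole round. -/
theorem State.give (hS : State A Λ L E K U V h e c m 1 (roundBound (Res L).ncard m))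
    {q q' : List α} (hq : (q, q') ∈ pairs L U V) {φ : Ψ} (hφ : Λ (h q q') = .eq φ) {a : α}
    (ha : a ∈ target L V q q' ↔ a ∉ A.den φ) :
    State A Λ L E K U V (h.give q q' (.ce a)) e c m 0 0 := by
  refine ⟨hS.table, hS.len, fun x y => ?_, ?_, ?_⟩
  · by_cases hxy : (x, y) = (q, q')
    · cases hxy
      rw [give_self]
      exact .ce (hS.valid _ _) hφ ha
    · rw [give_of_ne h _ hxy]
      exact hS.valid x y
  · intro hE
    have h1 := hS.eqs hE
    unfold eqBound at h1 ⊢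
    obtain ⟨n, h2, h3⟩ := exists_sum_give hq h (.ce a) numCE
    have h4 : numCE (.ce a :: h q q') = numCE (h q q') + 1 := by simp [numCE]
    omega
  · intro hE hK
    have h1 := hS.mqs hE hK
    unfold mqBound at h1 ⊢
    obtain ⟨n, h2, h3⟩ := exists_sum_give hq h (.ce a) numCE
    obtain ⟨n', h2', h3'⟩ := exists_sum_give hq h (.ce a) numAns
    have h4 : numCE (.ce a :: h q q') = numCE (h q q') + 1 := by simp [numCE]
    have h4' : numAns (.ce a :: h q q') = numAns (h q q') := by simp [numAns]
    rw [h3, h3', h4, h4']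
    rw [h2, h2'] at h1
    refine h1.trans (le_of_eq ?_)
    ring

theorem State.sat_giveCE (hL : (Res L).Finite) (hlearn : ∀ D ∈ arisingSets L, Learns A Λ D)
    (hS : State A Λ L E K U V h e c m 1 (roundBound (Res L).ncard m))
    (heq : ∀ p ∈ pairs L U V, ∃ φ, Λ (h p.1 p.2) = .eq φ)
    (ho : stateRank A Λ L U V h 0 ≤ o)
    {q q' : List α} (hq : (q, q') ∈ pairs L U V) {φ : Ψ} (hφ : Λ (h q q') = .eq φ) {a : α}
    (ha : a ∈ target L V q q' ↔ a ∉ A.den φ) :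
    LSat A Λ L E K o (giveCE A (tab L U V) h q q' a) e c m := by
  have hS' := hS.give hq hφ ha
  refine ⟨hS.bounded hL,
    ⟨U, V, rfl, hS', hq, Finset.empty_subset _, ?_⟩, lt_of_lt_of_le ?_ ho⟩
  · intro p hp hne _
    rw [give_of_ne h _ hne]
    exact heq p hp
  · refine Prod.Lex.toLex_lt_toLex.2 (.inr ⟨rfl, Prod.Lex.toLex_lt_toLex.2 (.inl ?_)⟩)
    refine histRank_give hlearn hq ?_
    have := hS'.valid q q'
    rwa [give_self] at this

theorem State.sat_continueBuild (hL : (Res L).Finite)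
    (hS : State A Λ L E K U V h e c m 0 0) {todo : Finset (List α × List α)}
    (htodo : todo ⊆ pairs L U V)
    (heq : ∀ p ∈ pairs L U V, p ∉ todo → ∃ φ, Λ (h p.1 p.2) = .eq φ)
    (ho : stateRank A Λ L U V h todo.card < o) :
    LSat A Λ L E K o (continueBuild A (tab L U V) h todo) e c m := by
  classical
  have hb := (hS.mono (e' := e) (c' := c) (xe' := 1) (xc' := roundBound (Res L).ncard m)
    (by omega) (by omega)).bounded hL
  refine sat_pickOr (fun p hp => ?_) (fun hemp => ?_)
  · refine ⟨hb, ⟨U, V, rfl, hS, htodo hp, (Finset.erase_subset _ _).trans htodo, ?_⟩, ?_⟩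
    · intro p' hp' hne hnot
      refine heq p' hp' fun hmem => hnot (Finset.mem_erase.2 ⟨?_, hmem⟩)
      exact hne
    · change stateRank A Λ L U V h ((todo.erase p).card + 1) < o
      rwa [Finset.card_erase_add_one hp]
  · have htodo0 : todo = ∅ := by
      ext p
      have : p ∉ {p | p ∈ todo} := by rw [hemp]; exact Set.notMem_empty p
      simpa using this
    subst htodo0
    exact ⟨hb, ⟨U, V, rfl, hS, fun p hp => heq p hp (Finset.notMem_empty _)⟩, ho⟩

end Parts

/-! ### Building hypotheses -/

section Build

variable {α : Type u} {Ψ : Type v} {A : PredAlg α Ψ} {Λ : PredLearner α Ψ} {L : Language α}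
  {E K : ℕ} {o : CtrlRank α} {U V U' V' : Finset (List α)} {h : Hist α} {e c m xe xc : ℕ}

theorem base_le_stateRank (k : ℕ) :
    toLex (2 * (4 * (Res L).ncard ^ 2 - progress L U V), toLex (0, 0)) ≤
      stateRank A Λ L U V h k := by
  refine Prod.Lex.toLex_le_toLex.2 (.inr ⟨rfl, Prod.Lex.toLex_le_toLex.2 ?_⟩)
  rcases eq_or_ne (histRank A Λ L U V h) 0 with h0 | h0
  · exact .inr ⟨h0.symm, Nat.zero_le _⟩
  · refine .inl (lt_of_le_of_ne (fun p => ?_) h0.symm)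
    exact zero_le

theorem mem_pairs {p : List α × List α} :
    p ∈ pairs L U V ↔ p.1 ∈ (tab L U V).Q ∧ p.2 ∈ (tab L U V).Q := Finset.mem_product

theorem TableInv.card_V_le (hT : TableInv L U V) (hL : (Res L).Finite) :
    V.card ≤ 4 * (Res L).ncard ^ 2 := hT.card_V.trans (progress_le hL hT.inj)

theorem sat_buildHypothesis (hL : (Res L).Finite)
    (hS : State A Λ L E K U V (fun _ _ => []) e c m 0 0) :
    LSat A Λ L E K (ctrlRank A Λ L (.build (tab L U V))) (buildHypothesis A (tab L U V)) e c m := by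
  refine hS.sat_continueBuild hL subset_rfl (fun p hp hnot => absurd hp hnot) ?_
  exact Prod.Lex.toLex_lt_toLex.2 (.inl (Nat.lt_succ_self _))

theorem State.sat_extend_new_row (hL : (Res L).Finite)
    (hS : State A Λ L E K U V h e c m 1 (roundBound (Res L).ncard m))
    (ho : toLex (2 * (4 * (Res L).ncard ^ 2 - progress L U V), toLex (0, 0)) ≤ o)
    [DecidableEq (List α)] {q : List α} {a : α} (hq : q ∈ U) (hV : V ⊆ V')
    (hcard : V'.card ≤ V.card + 1) (hlen : ∀ y ∈ V', y.length ≤ m + progress L U V + 1)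
    (hnew : ∀ x ∈ U, tr L V' x ≠ tr L V' (q ++ [a])) :
    LSat A Λ L E K o (extend A (tab L U V) (insert (q ++ [a]) U) V') e c m := by
  obtain ⟨hinj, hlt⟩ := progress_lt_of_new_row hL hS.table.inj hV hnew
  exact hS.sat_extend hL ho (hS.table.insert_U hq hV hcard hinj hlt) (Finset.subset_insert _ _) hV
    hlt hlen

/-- The row computed for the answer costs `|V| ≤ 4n²` queries, which are charged to that answer. -/
theorem State.ans (hS : State A Λ L E K U V h e c m 0 0) (hL : (Res L).Finite)
    {q q' : List α} (hq : (q, q') ∈ pairs L U V) {a : α} (ha : Λ (h q q') = .mq a) {b : Bool}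
    (hb : b = true ↔ a ∈ target L V q q') :
    State A Λ L E K U V (h.give q q' (.mq b)) e (c + V.card) m 0 0 := by
  classical
  refine ⟨hS.table, hS.len, fun x y => ?_, ?_, ?_⟩
  · by_cases hxy : (x, y) = (q, q')
    · cases hxy
      rw [give_self]
      have hb' : b = @decide (a ∈ target L V q q') (Classical.propDecidable _) := by
        rw [Bool.eq_iff_iff, hb, decide_eq_true_iff]
      rw [hb']
      exact .mq (hS.valid _ _) ha
    · rw [give_of_ne h _ hxy]
      exact hS.valid x y
  · intro hE
    have h1 := hS.eqs hE
    unfold eqBound at h1 ⊢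
    obtain ⟨n, h2, h3⟩ := exists_sum_give hq h (.mq b) numCE
    have h4 : numCE (.mq b :: h q q') = numCE (h q q') := by simp [numCE]
    omega
  · intro hE hK
    have h1 := hS.mqs hE hK
    have hV := hS.table.card_V_le hL
    unfold mqBound at h1 ⊢
    obtain ⟨n, h2, h3⟩ := exists_sum_give hq h (.mq b) numCE
    obtain ⟨n', h2', h3'⟩ := exists_sum_give hq h (.mq b) numAns
    have h4 : numCE (.mq b :: h q q') = numCE (h q q') := by simp [numCE]
    have h4' : numAns (.mq b :: h q q') = numAns (h q q') + 1 := by simp [numAns]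
    rw [h3, h3', h4, h4']
    rw [h2, h2'] at h1
    rw [add_right_comm _ 1, add_mul _ 1, one_mul]
    omega

theorem sat_updateTransition (hL : (Res L).Finite)
    (hlearn : ∀ D ∈ arisingSets L, Learns A Λ D) (hS : State A Λ L E K U V h e c m 0 0)
    {q q' : List α} {todo : Finset (List α × List α)} (hq : (q, q') ∈ pairs L U V)
    (htodo : todo ⊆ pairs L U V)
    (heq : ∀ p ∈ pairs L U V, p ≠ (q, q') → p ∉ todo → ∃ φ, Λ (h p.1 p.2) = .eq φ) :
    LSat A Λ L E K (stateRank A Λ L U V h (todo.card + 1))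
      (updateTransition A Λ (tab L U V) h q q' todo) e c m := by
  classical
  unfold updateTransition
  split
  · rename_i a ha
    have hqU := tab_Q_sub (mem_pairs.1 hq).1
    have hV := hS.table.card_V_le hL
    apply sat_askRow
    split_ifs with hprm
    · refine State.sat_extend_new_row hL (hS.mono (c' := c + V.card) (by omega) ?_)
        (base_le_stateRank _) hqU subset_rfl (Nat.le_succ _)
        (fun y hy => (hS.len y hy).trans (by omega)) ?_
      · unfold roundBound; omega
      -- An old row would leave the set of rows unchanged, so it could not become prime by being
      -- added.
      · rw [tab_rows, tab_V] at hprm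
        intro x hx hxq
        refine hprm.2 ?_
        have hmem : tr L V (q ++ [a]) ∈ tr L V '' U := ⟨x, hx, hxq⟩
        have h1 := hprm.1
        rwa [Set.union_singleton, Set.insert_eq_of_mem hmem] at h1
    · have hS' := hS.ans hL hq ha (b := decide ((tab L U V).row q' ⊆ tr L V (q ++ [a])))
        (by rw [decide_eq_true_iff, tab_row (tab_Q_sub (mem_pairs.1 hq).2)]; rfl)
      refine ⟨(hS'.mono (e' := e) (c' := c + V.card) (by omega) (by omega)).bounded hL,
        ⟨U, V, rfl, hS', hq, htodo, ?_⟩, ?_⟩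
      · intro p hp hne hnot
        rw [give_of_ne h _ hne]
        exact heq p hp hne hnot
      · refine Prod.Lex.toLex_lt_toLex.2 (.inr ⟨rfl, Prod.Lex.toLex_lt_toLex.2 (.inl ?_)⟩)
        refine histRank_give hlearn hq ?_
        have := hS'.valid q q'
        rwa [give_self] at this
  · rename_i φ hφ
    refine hS.sat_continueBuild hL htodo (fun p hp hnot => ?_) ?_
    · by_cases hne : p = (q, q')
      · subst hne; exact ⟨φ, hφ⟩
      · exact heq p hp hne hnot
    · exact Prod.Lex.toLex_lt_toLex.2 (.inr ⟨rfl, Prod.Lex.toLex_lt_toLex.2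
        (.inr ⟨rfl, Nat.lt_succ_self _⟩)⟩)

end Build

/-! ### Confirming the conditions and processing counterexamples -/

section Confirm

variable {α : Type u} {Ψ : Type v} {A : PredAlg α Ψ} {Λ : PredLearner α Ψ} {L : Language α}
  {E K : ℕ} {o : CtrlRank α} {U V : Finset (List α)} {h : Hist α} {e c m : ℕ} {q q' x y : List α}
  {a : α}

theorem iff_not_of_not_iff {p q : Prop} (h : ¬ (p ↔ q)) : p ↔ ¬ q := by
  tauto

variable (A Λ L) in
/-- All instances of the predicate learner are suspended at equivalence queries, and jumps to control
points of ranks below that of the present state are allowed. -/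
structure Ready (U V : Finset (List α)) (h : Hist α) (o : CtrlRank α) : Prop where
  finite : (Res L).Finite
  learns : ∀ D ∈ arisingSets L, Learns A Λ D
  pending : ∀ p ∈ pairs L U V, ∃ φ, Λ (h p.1 p.2) = .eq φ
  rank : stateRank A Λ L U V h 0 ≤ o

theorem mem_hyp_trans {φ : Ψ} : (q, φ, q') ∈ (hyp A Λ (tab L U V) h).trans ↔
    (q, q') ∈ pairs L U V ∧ Λ (h q q') = .eq φ := by
  simp only [hyp, hypTrans, Finset.mem_biUnion]
  constructor
  · rintro ⟨p, hp, hmem⟩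
    split at hmem
    · simp at hmem
    · rename_i ψ hψ
      simp only [Finset.mem_singleton, Prod.mk.injEq] at hmem
      obtain ⟨rfl, rfl, rfl⟩ := hmem
      exact ⟨hp, hψ⟩
  · rintro ⟨hp, hφ⟩
    exact ⟨(q, q'), hp, by simp [hφ]⟩

theorem mem_hyp_δ : q' ∈ (hyp A Λ (tab L U V) h).δ q a ↔
    (q, q') ∈ pairs L U V ∧ ∃ φ, Λ (h q q') = .eq φ ∧ a ∈ A.den φ := by
  constructor
  · rintro ⟨φ, h1, h2⟩
    rw [mem_hyp_trans] at h1
    exact ⟨h1.1, φ, h1.2, h2⟩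
  · rintro ⟨h1, φ, h2, h3⟩
    exact ⟨φ, mem_hyp_trans.2 ⟨h1, h2⟩, h3⟩

theorem reach_sub_Q (hx : q ∈ (hyp A Λ (tab L U V) h).reach x) : q ∈ (tab L U V).Q :=
  SFA.reach_sub_states hx

theorem mem_reachFinset :
    q ∈ reachFinset A Λ (tab L U V) h x ↔ q ∈ (hyp A Λ (tab L U V) h).reach x := by
  classical
  unfold reachFinset
  rw [Finset.mem_filter]
  exact ⟨fun h => h.2, fun h => ⟨reach_sub_Q h, h⟩⟩

theorem card_reachFinset_le : (reachFinset A Λ (tab L U V) h x).card ≤ (tab L U V).Q.card := by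
  classical
  exact Finset.card_filter_le _ _

theorem mem_hyp_F (hT : TableInv L U V) (hq : q ∈ (tab L U V).Q) :
    [] ∈ (hyp A Λ (tab L U V) h).langFrom q ↔ q ∈ L := by
  rw [SFA.nil_mem_langFrom]
  exact (mem_tab_F hT.nil_V).trans (and_iff_right hq)

/-- The answers `+` among the membership queries on the strings `qy`, `q ∈ X`. -/
theorem mem_answers {X : Finset (List α)} (hq : q ∈ X) :
    q ++ y ∈ ({z | z ∈ X.toList.map (· ++ y) ∧ z ∈ L} : Set (List α)) ↔ q ++ y ∈ L :=
  and_iff_right (List.mem_map.2 ⟨q, Finset.mem_toList.2 hq, rfl⟩)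

theorem State.sat_giveCE_of_δ (hR : Ready A Λ L U V h o)
    (hS : State A Λ L E K U V h e c m 1 (roundBound (Res L).ncard m))
    (hq : (q, q') ∈ pairs L U V)
    (ha : tr L V q' ⊆ tr L V (q ++ [a]) ↔ q' ∉ (hyp A Λ (tab L U V) h).δ q a) :
    LSat A Λ L E K o (giveCE A (tab L U V) h q q' a) e c m := by
  obtain ⟨φ, hφ⟩ := hR.pending _ hq
  refine hS.sat_giveCE hR.finite hR.learns hR.pending hR.rank hq hφ (ha.trans (not_congr ?_))
  rw [mem_hyp_δ]
  constructor
  · rintro ⟨-, ψ, h1, h2⟩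
    rw [hφ] at h1
    cases h1
    exact h2
  · exact fun h => ⟨hq, φ, hφ, h⟩

theorem State.sat_extend_split [DecidableEq (List α)]
    (hR : Ready A Λ L U V h o)
    (hS : State A Λ L E K U V h e c m 1 (roundBound (Res L).ncard m)) {z : List α}
    (hlen : y.length ≤ m + progress L U V + 1) (hsub : tr L V x ⊆ tr L V z) (hx : x ++ y ∈ L)
    (hz : z ++ y ∉ L) :
    LSat A Λ L E K o (extend A (tab L U V) U (insert y V)) e c m := by
  have hlt : progress L U V < progress L U (insert y V) :=
    progress_lt_of_split hR.finite hS.table.inj (Finset.subset_insert _ _) hsub fun hcon =>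
      hz (hcon ⟨Finset.mem_insert_self _ _, hx⟩).2
  refine hS.sat_extend hR.finite ((base_le_stateRank 0).trans hR.rank) (hS.table.insert_V hlt)
    subset_rfl (Finset.subset_insert _ _) hlt fun v hv => ?_
  rcases Finset.mem_insert.1 hv with rfl | hv
  · exact hlen
  · exact (hS.len v hv).trans (by omega)

theorem State.sat_extend_uncovered [DecidableEq (List α)]
    (hR : Ready A Λ L U V h o)
    (hS : State A Λ L E K U V h e c m 1 (roundBound (Res L).ncard m))
    (hlen : y.length ≤ m + progress L U V + 1) (hxU : x ∈ U) (hx : x ++ y ∈ L)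
    (hlow : ∀ p ∈ (tab L U V).Q, tr L V p ⊆ tr L V x → p ++ y ∉ L) :
    LSat A Λ L E K o (extend A (tab L U V) U (insert y V)) e c m := by
  have hlt := progress_lt_of_uncovered hR.finite hS.table.inj hxU hx hlow
  refine hS.sat_extend hR.finite ((base_le_stateRank 0).trans hR.rank) (hS.table.insert_V hlt)
    subset_rfl (Finset.subset_insert _ _) hlt fun v hv => ?_
  rcases Finset.mem_insert.1 hv with rfl | hv
  · exact hlen
  · exact (hS.len v hv).trans (by omega)

/-- No state with a row below that of `qa` is led into `L` by `y`. If an `x` in `U` with the same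
row has `xy` in `L`, then `y` is uncovered at `x`. Otherwise `y` separates `qa` from all elements of
`U` with that row, and `qa` brings a new one. The `n` extra queries in `hS` pay for the test. -/
theorem State.sat_extendBySuffix (hR : Ready A Λ L U V h o)
    (hS : State A Λ L E K U V h e (c + (Res L).ncard) m 1 (roundBound (Res L).ncard m))
    (hlen : y.length ≤ m + progress L U V + 1) (hqU : q ∈ U) (hq : q ++ a :: y ∈ L)
    (hlow : ∀ p ∈ (tab L U V).Q, tr L V p ⊆ tr L V (q ++ [a]) → p ++ y ∉ L) :
    LSat A Λ L E K o (extendBySuffix A (tab L U V) (tr L V (q ++ [a])) (q ++ [a]) y) e c m := by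
  classical
  apply sat_askSet
  set X := (tab L U V).U.filter fun x => (tab L U V).row x = tr L V (q ++ [a]) with hX
  have hXcard : X.card ≤ (Res L).ncard :=
    (Finset.card_filter_le _ _).trans (card_U_le hR.finite hS.table.inj)
  have hS' : State A Λ L E K U V h e (c + (X.toList.map (· ++ y)).length) m 1
      (roundBound (Res L).ncard m) := by
    refine hS.mono le_rfl ?_
    rw [List.length_map, Finset.length_toList]
    omega
  split_ifs with hu
  · obtain ⟨x, hx, hrow, hxy⟩ := hu
    rw [tab_row (show x ∈ U from hx)] at hrow
    refine hS'.sat_extend_uncovered hR hlen hx hxy.2 fun p hp hsub => hlow p hp ?_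
    rwa [← hrow]
  · refine hS'.sat_extend_new_row hR.finite ((base_le_stateRank 0).trans hR.rank) hqU
      (Finset.subset_insert _ _) (Finset.card_insert_le _ _) (fun v hv => ?_) ?_
    · rcases Finset.mem_insert.1 hv with rfl | hv
      · exact hlen
      · exact (hS.len v hv).trans (by omega)
    · intro x hx heq
      have hrow := tr_eq_mono_V (Finset.subset_insert _ _) heq
      refine hu ⟨x, hx, (tab_row hx).trans hrow, ?_⟩
      have hxX : x ∈ X := Finset.mem_filter.2 ⟨hx, (tab_row hx).trans hrow⟩
      refine (mem_answers hxX).2 ?_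
      have : y ∈ tr L (insert y V) (q ++ [a]) :=
        ⟨Finset.mem_insert_self _ _, by rwa [List.append_assoc, List.singleton_append]⟩
      change tr L (insert y V) x = tr L (insert y V) (q ++ [a]) at heq
      rw [← heq] at this
      exact this.2

/-- If both edges are right at `a`, some `y` in the row of `x` is accepted after `qa` but not after
`q'a`, so `ay` refutes the inclusion of the row of `q` in that of `q'`. The two rows computed here
account for the `8n²` in `roundBound`. -/
theorem State.sat_confirm1 (hR : Ready A Λ L U V h o) (hS : State A Λ L E K U V h e c m 0 0)
    {p : LProg A}
    (hp : (∀ q ∈ (tab L U V).Q, ∀ q' ∈ (tab L U V).Q, tr L V q ⊆ tr L V q' → ∀ a,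
      (hyp A Λ (tab L U V) h).δ q a ⊆ (hyp A Λ (tab L U V) h).δ q' a) →
      LSat A Λ L E K o p e c m) :
    LSat A Λ L E K o (confirm1 A Λ (tab L U V) h p) e c m := by
  classical
  have hV := hS.table.card_V_le hR.finite
  refine sat_pickOr ?_ fun hemp => hp ?_
  · rintro _ ⟨q, q', x, a, rfl, hq, hq', hsub, hx, φ, φ', hφ, hφ', ha⟩
    have hqU := tab_Q_sub hq
    have hqU' := tab_Q_sub hq'
    have hxU := tab_Q_sub hx
    rw [tab_row hqU, tab_row hqU'] at hsub
    rw [A.den_and, A.den_not] at ha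
    have hδ : x ∈ (hyp A Λ (tab L U V) h).δ q a := ⟨φ, hφ, ha.1⟩
    have hδ' : x ∉ (hyp A Λ (tab L U V) h).δ q' a := by
      rw [mem_hyp_δ]
      rintro ⟨-, ψ, h1, h2⟩
      rw [(mem_hyp_trans.1 hφ').2] at h1
      cases h1
      exact ha.2 h2
    dsimp only
    apply sat_askRow
    rw [tab_row hxU, tab_V]
    split_ifs with h1
    swap
    · refine State.sat_giveCE_of_δ hR (hS.mono (by omega) ?_) (mem_pairs.2 ⟨hq, hx⟩) ?_
      · unfold roundBound; omega
      · exact iff_of_false h1 (not_not.2 hδ)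
    · apply sat_askRow
      split_ifs with h2
      · refine State.sat_giveCE_of_δ hR (hS.mono (by omega) ?_) (mem_pairs.2 ⟨hq', hx⟩) ?_
        · unfold roundBound; omega
        · exact iff_of_true h2 hδ'
      · obtain ⟨y, hy, hy'⟩ := Set.not_subset.1 h2
        refine ⟨⟨y, hy.1, hy, hy'⟩, ?_⟩
        rintro v ⟨hvV, hv, hv'⟩
        refine State.sat_extend_split hR (hS.mono (by omega) ?_) ?_ hsub ?_ ?_
        · unfold roundBound; omega
        · have := hS.len v hvV
          rw [List.length_cons]; omega
        · have := (h1 hv).2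
          rwa [List.append_assoc, List.singleton_append] at this
        · intro hcon
          refine hv' ⟨hvV, ?_⟩
          rwa [List.append_assoc, List.singleton_append]
  · intro q hq q' hq' hsub a x hx
    by_contra hx'
    obtain ⟨hpair, φ, hφ, ha⟩ := mem_hyp_δ.1 hx
    have hpair' : (q', x) ∈ pairs L U V := mem_pairs.2 ⟨hq', (mem_pairs.1 hpair).2⟩
    obtain ⟨φ', hφ'⟩ := hR.pending _ hpair'
    refine (Set.eq_empty_iff_forall_notMem.1 hemp) (q, q', x, a) ⟨q, q', x, a, rfl, hq, hq', ?_,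
      (mem_pairs.1 hpair).2, φ, φ', mem_hyp_trans.2 ⟨hpair, hφ⟩, mem_hyp_trans.2 ⟨hpair', hφ'⟩, ?_⟩
    · rwa [tab_row (tab_Q_sub hq), tab_row (tab_Q_sub hq')]
    · rw [A.den_and, A.den_not]
      exact ⟨ha, fun hcon => hx' (mem_hyp_δ.2 ⟨hpair', φ', hφ', hcon⟩)⟩

/-- By prefix-closedness and minimality, or by the choice of `Q₀` if `x'` is empty, the row of `s'`
lies below that of `x'`. If the edge is right at `a`, a suffix in the row of `s` but not in that of
`x'a` gives, with `a` in front, a refutation of this inclusion. -/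
theorem State.sat_confirm2 (hR : Ready A Λ L U V h o) (hS : State A Λ L E K U V h e c m 0 0)
    {p : LProg A}
    (hp : (∀ x ∈ U, x ≠ [] → ∀ s ∈ (hyp A Λ (tab L U V) h).reach x, tr L V s ⊆ tr L V x) →
      LSat A Λ L E K o p e c m) :
    LSat A Λ L E K o (confirm2 A Λ (tab L U V) h p) e c m := by
  classical
  have hV := hS.table.card_V_le hR.finite
  have hrow : ∀ x s, s ∈ (hyp A Λ (tab L U V) h).reach x → (tab L U V).row s = tr L V s :=
    fun x s hs => tab_row (tab_Q_sub (reach_sub_Q hs))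
  refine sat_pickOr ?_ fun hemp => hp ?_
  · rintro _ ⟨x, s, rfl, hx, hx0, hmin, hs, hsub⟩
    rw [tab_U] at hx hmin
    rw [hrow x s hs, tab_row hx] at hsub
    dsimp only
    refine ⟨?_, ?_⟩
    · obtain ⟨x', a, rfl⟩ := List.eq_nil_or_concat' x |>.resolve_left hx0
      obtain ⟨s', hs', hδ⟩ := SFA.mem_reach_append_singleton.1 hs
      exact ⟨(x', a, s'), x', a, s', rfl, rfl, hs', hδ⟩
    · rintro _ ⟨x', a, s', rfl, rfl, hs', hδ⟩
      have hx'U : x' ∈ U := hS.table.prefix_closed _ _ hx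
      have hle : tr L V s' ⊆ tr L V x' := by
        by_cases hx'0 : x' = []
        · subst hx'0
          rw [SFA.mem_reach_nil] at hs'
          exact ((mem_tab_Q₀ hS.table.nil_U).1 hs').2
        · have := hmin x' hx'U hx'0 (by simp) s' hs'
          rwa [hrow x' s' hs', tab_row hx'U] at this
      dsimp only
      apply sat_askRow
      rw [hrow _ s hs, tab_row hx, tab_V]
      split_ifs with h1
      swap
      · refine State.sat_giveCE_of_δ hR (hS.mono (by omega) ?_) (mem_hyp_δ.1 hδ).1 ?_
        · unfold roundBound; omega
        · exact iff_of_false h1 (not_not.2 hδ)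
      · obtain ⟨y, hy, hy'⟩ := Set.not_subset.1 hsub
        refine ⟨⟨y, hy.1, h1 hy, hy'⟩, ?_⟩
        rintro v ⟨hvV, hv, hv'⟩
        refine State.sat_extend_split hR (hS.mono (by omega) ?_) ?_ hle ?_ ?_
        · unfold roundBound; omega
        · have := hS.len v hvV
          rw [List.length_cons]; omega
        · have := hv.2
          rwa [List.append_assoc, List.singleton_append] at this
        · intro hcon
          refine hv' ⟨hvV, ?_⟩
          rwa [List.append_assoc, List.singleton_append]
  · intro x
    induction hn : x.length using Nat.strong_induction_on generalizing x with
    | _ n ih =>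
    intro hx hx0 s hs
    by_contra hcon
    refine (Set.eq_empty_iff_forall_notMem.1 hemp) (x, s) ⟨x, s, rfl, hx, hx0, ?_, hs, ?_⟩
    · intro x' hx' hx'0 hlt s' hs'
      rw [tab_U] at hx'
      rw [hrow _ s' hs', tab_row hx']
      exact ih _ (hn ▸ hlt) x' rfl hx' hx'0 s' hs'
    · rwa [hrow _ s hs, tab_row hx]

/-- The search isolates a letter `a` such that the hypothesis is right about `y'` at all states and
wrong about `ay'` at `q₂`. If the edges leaving `q₂` are right at `a`, the error lies in the table:
either a successor accepts too much, and `y'` splits it from `q₂a`, or no state below `q₂a` accounts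
for `y'`. -/
theorem State.sat_confirm3 (hR : Ready A Λ L U V h o) (hS : State A Λ L E K U V h e c m 0 0)
    {p : LProg A}
    (hp : (∀ y ∈ V, y ≠ [] → ∀ q ∈ (tab L U V).Q,
      (y ∈ tr L V q ↔ y ∈ (hyp A Λ (tab L U V) h).langFrom q)) → LSat A Λ L E K o p e c m) :
    LSat A Λ L E K o (confirm3 A Λ (tab L U V) h p) e c m := by
  classical
  have hV := hS.table.card_V_le hR.finite
  have hQ := card_Q_le hR.finite hS.table.inj
  have hprog := progress_le hR.finite hS.table.inj
  refine sat_pickOr ?_ fun hemp => hp ?_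
  · rintro y ⟨hyV, hy0, q, hq, hqy⟩
    rw [tab_V] at hyV
    refine sat_bsearch (t := fun i => ∃ q ∈ (tab L U V).Q,
        (q ++ y.drop i ∈ L ↔ y.drop i ∉ (hyp A Λ (tab L U V) h).langFrom q))
      (wt := (tab L U V).Q.card) (fun _ _ _ _ h h' => h'.antitone h)
      (fun _ _ _ _ _ h h' => h'.antitone h)
      ?_ ?_ ?_ ?_
    · intro i k c' hk
      apply sat_askSet
      rw [List.length_map, Finset.length_toList]
      convert hk using 3
      exact exists_congr fun q => and_congr_right fun hq => iff_congr (mem_answers hq) Iff.rfl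
    · refine ⟨q, hq, ?_⟩
      rw [List.drop_zero, ← hqy, tab_row (tab_Q_sub hq)]
      exact (and_iff_right hyV).symm
    -- The hypothesis is right about the empty suffix, since final states are read off the table.
    · rintro ⟨q, hq, h1⟩
      rw [Nat.zero_add, List.drop_length, List.append_nil, mem_hyp_F hS.table hq] at h1
      exact iff_not_self h1
    · intro i _ hi hti hti'
      rw [Nat.zero_add] at hi
      refine ⟨⟨(y[i], y.drop (i + 1)), List.drop_eq_getElem_cons hi⟩, ?_⟩
      rintro ⟨a, y'⟩ hay
      change y.drop i = a :: y' at hay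
      have hy' : y.drop (i + 1) = y' := by
        rw [← List.tail_drop, hay, List.tail_cons]
      have hylen : y'.length ≤ y.length := by rw [← hy', List.length_drop]; omega
      have hVlen := hS.len y hyV
      have hclog : Nat.clog 2 y.length ≤ Nat.clog 2 (m + 4 * (Res L).ncard ^ 2) :=
        Nat.clog_mono_right _ (by omega)
      have hcost := Nat.mul_le_mul hQ hclog
      rw [hay] at hti
      rw [hy'] at hti'
      dsimp only
      apply sat_askSet
      rw [List.length_map, Finset.length_toList]
      refine ⟨?_, ?_⟩
      · obtain ⟨q, hq, h1⟩ := hti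
        exact ⟨q, hq, (mem_answers hq).trans h1⟩
      · rintro q₂ ⟨hq₂, h2⟩
        rw [mem_answers hq₂] at h2
        apply sat_askRow
        rw [tab_V]
        refine sat_pickOr ?_ fun hnone => ?_
        · rintro q₃ ⟨hq₃, h3⟩
          refine State.sat_giveCE_of_δ hR (hS.mono (by omega) ?_) (mem_pairs.2 ⟨hq₂, hq₃⟩) ?_
          · unfold roundBound; omega
          · rwa [tab_row (tab_Q_sub hq₃)] at h3
        · have hδ : ∀ r ∈ (tab L U V).Q,
              (tr L V r ⊆ tr L V (q₂ ++ [a]) ↔ r ∈ (hyp A Λ (tab L U V) h).δ q₂ a) := by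
            intro r hr
            by_contra hcon
            refine (Set.eq_empty_iff_forall_notMem.1 hnone) r ⟨hr, ?_⟩
            rw [tab_row (tab_Q_sub hr)]
            exact iff_not_of_not_iff hcon
          have hsuf : ∀ r ∈ (tab L U V).Q,
              (r ++ y' ∈ L ↔ y' ∈ (hyp A Λ (tab L U V) h).langFrom r) := by
            intro r hr
            by_contra hcon
            exact hti' ⟨r, hr, iff_not_of_not_iff hcon⟩
          split_ifs with h4
          all_goals rw [mem_answers hq₂] at h4
          swap
          · have h5 : a :: y' ∈ (hyp A Λ (tab L U V) h).langFrom q₂ := by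
              by_contra hcon
              exact h4 (h2.2 hcon)
            obtain ⟨r, hr, hy'r⟩ := SFA.cons_mem_langFrom.1 h5
            have hrQ : r ∈ (tab L U V).Q := (mem_pairs.1 (mem_hyp_δ.1 hr).1).2
            refine State.sat_extend_split hR (hS.mono (by omega) ?_) (by omega)
              ((hδ r hrQ).2 hr) ((hsuf r hrQ).2 hy'r) ?_
            · unfold roundBound; omega
            · rwa [List.append_assoc, List.singleton_append]
          · refine State.sat_extendBySuffix hR (hS.mono (by omega) ?_) (by omega)
              (tab_Q_sub hq₂) h4 ?_
            · unfold roundBound; omega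
            · intro r hr hsub hcon
              exact h2.1 h4 (SFA.cons_mem_langFrom.2 ⟨r, (hδ r hr).1 hsub, (hsuf r hr).1 hcon⟩)
  · intro y hy hy0 q hq
    by_contra hcon
    refine (Set.eq_empty_iff_forall_notMem.1 hemp) y ⟨hy, hy0, q, hq, ?_⟩
    rw [tab_row (tab_Q_sub hq)]
    exact iff_not_of_not_iff hcon

/-- If the initial states misjudge `x`, then `x` is uncovered at the empty string or splits an
initial state from it. Otherwise the test agrees with the teacher at the start and, `x` being a
counterexample, disagrees at the end, so some letter loses the agreement. -/
theorem State.sat_handleCE (hR : Ready A Λ L U V h o)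
    (hS : State A Λ L E K U V h e c m 1 0) {x : List α} (hxm : x.length ≤ m)
    (hx : x ∈ L ↔ x ∉ (hyp A Λ (tab L U V) h).lang) :
    LSat A Λ L E K o (handleCE A Λ (tab L U V) h x) e c m := by
  classical
  have hV := hS.table.card_V_le hR.finite
  have hQ := card_Q_le hR.finite hS.table.inj
  have hclog : Nat.clog 2 x.length ≤ Nat.clog 2 (m + 4 * (Res L).ncard ^ 2) :=
    Nat.clog_mono_right _ (by omega)
  have hcost := Nat.mul_le_mul hQ hclog
  have hQ0 : (tab L U V).Q₀.card ≤ (tab L U V).Q.card := Finset.card_filter_le _ _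
  apply sat_askSet
  rw [List.length_cons, List.length_map, Finset.length_toList]
  set P : Set (List α) := {z | z ∈ x :: (tab L U V).Q₀.toList.map (· ++ x) ∧ z ∈ L} with hP
  have hxP : x ∈ P ↔ x ∈ L := and_iff_right List.mem_cons_self
  have hstart : (∃ q ∈ (tab L U V).Q₀, q ++ x ∈ P) ↔ ∃ q ∈ (tab L U V).Q₀, q ++ x ∈ L :=
    exists_congr fun q => and_congr_right fun hq => and_iff_right
      (List.mem_cons_of_mem _ (List.mem_map.2 ⟨q, Finset.mem_toList.2 hq, rfl⟩))
  have hmemQ0 : ∀ q, q ∈ (tab L U V).Q₀ ↔ q ∈ (tab L U V).Q ∧ tr L V q ⊆ tr L V [] :=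
    fun q => mem_tab_Q₀ hS.table.nil_U
  split_ifs with h1
  all_goals rw [hstart, hxP] at h1
  swap
  · have hS' : State A Λ L E K U V h e (c + ((tab L U V).Q₀.card + 1)) m 1
        (roundBound (Res L).ncard m) := by
      refine hS.mono le_rfl ?_
      unfold roundBound; omega
    by_cases hxL : x ∈ L
    · refine hS'.sat_extend_uncovered hR (by omega) hS.table.nil_U hxL fun q hq hsub hcon => ?_
      exact h1 (iff_of_true ⟨q, (hmemQ0 q).2 ⟨hq, hsub⟩, hcon⟩ hxL)
    · obtain ⟨q, hq, hqx⟩ : ∃ q ∈ (tab L U V).Q₀, q ++ x ∈ L := by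
        by_contra hcon
        exact h1 (iff_of_false hcon hxL)
      exact hS'.sat_extend_split hR (by omega) ((hmemQ0 q).1 hq).2 hqx hxL
  · refine sat_bsearch (t := fun i =>
        (∃ q, q ∈ (hyp A Λ (tab L U V) h).reach (x.take i) ∧ q ++ x.drop i ∈ L) ↔ x ∈ L)
      (wt := (tab L U V).Q.card) (fun _ _ _ _ h h' => h'.antitone h)
      (fun _ _ _ _ _ h h' => h'.antitone h)
      ?_ ?_ ?_ ?_
    · intro i k c' hk
      apply sat_askSet
      rw [List.length_map, Finset.length_toList]
      refine LSat.antitone (c := c' + (tab L U V).Q.card) ?_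
        (Nat.add_le_add_left card_reachFinset_le _)
      convert hk using 3
      exact iff_congr (exists_congr fun q => (and_congr_right fun hq => mem_answers hq).trans
        (and_congr_left fun _ => mem_reachFinset)) hxP
    · rw [List.take_zero, List.drop_zero, ← h1]
      exact exists_congr fun q => and_congr_left fun _ => SFA.mem_reach_nil
    · rw [Nat.zero_add, List.take_length, List.drop_length]
      intro hcon
      have : (∃ q, q ∈ (hyp A Λ (tab L U V) h).reach x ∧ q ++ [] ∈ L) ↔
          x ∈ (hyp A Λ (tab L U V) h).lang := by
        conv_rhs => rw [← List.append_nil x, SFA.append_mem_lang]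
        refine exists_congr fun q => and_congr_right fun hq => ?_
        rw [List.append_nil, mem_hyp_F hS.table (reach_sub_Q hq)]
      rw [this] at hcon
      exact iff_not_self (hcon.trans hx)
    · intro i _ hi hti hti'
      rw [Nat.zero_add] at hi
      refine ⟨⟨(x[i], x.drop (i + 1)), List.drop_eq_getElem_cons hi⟩, ?_⟩
      rintro ⟨a, y⟩ hay
      change x.drop i = a :: y at hay
      have hy : x.drop (i + 1) = y := by rw [← List.tail_drop, hay, List.tail_cons]
      have hylen : y.length ≤ x.length := by rw [← hy, List.length_drop]; omega
      have htake : x.take (i + 1) = x.take i ++ [a] := by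
        have h2 := List.drop_eq_getElem_cons hi
        rw [hay] at h2
        rw [List.take_succ_eq_append_getElem hi, (List.cons.inj h2).1]
      rw [hay] at hti
      rw [hy, htake] at hti'
      have hreach : ∀ z, (reachFinset A Λ (tab L U V) h z).card ≤ (tab L U V).Q.card :=
        fun z => card_reachFinset_le
      have hreach1 := hreach (x.take i)
      have hreach2 := hreach (x.take i ++ [a])
      dsimp only
      apply sat_askSet
      rw [List.length_map, Finset.length_toList]
      split_ifs with h2
      · obtain ⟨q, hq, hqR⟩ := h2
        refine ⟨⟨q, hq, hqR⟩, ?_⟩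
        rintro q ⟨hq, hqR⟩
        have hqL := hqR.2
        rw [mem_reachFinset] at hq
        have hqQ := reach_sub_Q hq
        -- A successor that `y` leads into `L` would restore the agreement at `i + 1`.
        have hnone : ∀ r ∈ (hyp A Λ (tab L U V) h).δ q a, r ++ y ∉ L := by
          intro r hr hcon
          exact hti' ⟨fun _ => hti.1 ⟨q, hq, hqL⟩,
            fun _ => ⟨r, SFA.mem_reach_append_singleton.2 ⟨q, hq, hr⟩, hcon⟩⟩
        apply sat_askRow
        rw [tab_V]
        refine sat_pickOr ?_ fun hemp => ?_
        · rintro q' ⟨hq', hsub, hδ⟩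
          refine State.sat_giveCE_of_δ hR (hS.mono (by omega) ?_) (mem_pairs.2 ⟨hqQ, hq'⟩) ?_
          · unfold roundBound; omega
          · rw [tab_row (tab_Q_sub hq')] at hsub
            exact iff_of_true hsub hδ
        · refine State.sat_extendBySuffix hR (hS.mono (by omega) ?_) (by omega) (tab_Q_sub hqQ)
            hqL ?_
          · unfold roundBound; omega
          · intro r hr hsub
            refine hnone r ?_
            by_contra hcon
            refine (Set.eq_empty_iff_forall_notMem.1 hemp) r ⟨hr, ?_, hcon⟩
            rwa [tab_row (tab_Q_sub hr)]
      · have hneg : ∀ q ∈ (hyp A Λ (tab L U V) h).reach (x.take i), q ++ a :: y ∉ L :=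
          fun q hq hcon => h2 ⟨q, mem_reachFinset.2 hq, (mem_answers (mem_reachFinset.2 hq)).2 hcon⟩
        have hpos : ∃ q, q ∈ (hyp A Λ (tab L U V) h).reach (x.take i ++ [a]) ∧ q ++ y ∈ L := by
          by_contra hcon
          refine hti' (iff_of_false hcon fun hxL => ?_)
          obtain ⟨q, hq, hqL⟩ := hti.2 hxL
          exact hneg q hq hqL
        apply sat_askSet
        rw [List.length_map, Finset.length_toList]
        refine ⟨?_, ?_⟩
        · obtain ⟨q', hq', hq'L⟩ := hpos
          obtain ⟨q, hq, hδ⟩ := SFA.mem_reach_append_singleton.1 hq'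
          exact ⟨(q, q'), mem_reachFinset.2 hq, hδ, fun hcon => hneg q hq hcon.2,
            (mem_answers (mem_reachFinset.2 hq')).2 hq'L⟩
        · rintro ⟨q, q'⟩ ⟨hq, hδ, -, hq'⟩
          have hq'L := hq'.2
          rw [mem_reachFinset] at hq
          have hpair := (mem_hyp_δ.1 hδ).1
          dsimp only
          apply sat_askRow
          rw [tab_V, tab_row (tab_Q_sub (mem_pairs.1 hpair).2)]
          split_ifs with h3
          swap
          · refine State.sat_giveCE_of_δ hR (hS.mono (by omega) ?_) hpair ?_
            · unfold roundBound; omega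
            · exact iff_of_false h3 (not_not.2 hδ)
          · refine State.sat_extend_split hR (hS.mono (by omega) ?_) (by omega) h3 hq'L ?_
            · unfold roundBound; omega
            · rw [List.append_assoc, List.singleton_append]
              exact hneg q hq

theorem State.sat_confirm (hR : Ready A Λ L U V h o) (hS : State A Λ L E K U V h e c m 0 0) :
    LSat A Λ L E K o (learner A Λ (.confirm (tab L U V) h)) e c m := by
  refine hS.sat_confirm1 hR fun h1 => hS.sat_confirm2 hR fun h2 => hS.sat_confirm3 hR fun h3 => ?_
  refine ⟨(hS.mono (e' := e) (c' := c) (xe' := 1) (xc' := roundBound (Res L).ncard m)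
    (by omega) (by omega)).bounded hR.finite, fun hyes => ⟨(hS.mono (e' := e + 1) (c' := c)
      (xe' := 1) (xc' := roundBound (Res L).ncard m) (by omega) (by omega)).bounded hR.finite, ?_⟩,
    fun x hx => ?_⟩
  · have := isResidual_isReduced_of_conditions hS.table hyes rfl rfl rfl h1 h2 h3
    exact ⟨this.1, this.2, hyes⟩
  -- The EQ just raised is the slack of one; the counterexample may raise `m`.
  · refine State.sat_handleCE hR ((hS.mono_maxCE (le_max_left m x.length)).mono ?_ ?_)
      (le_max_right m x.length) hx
    · omega
    · omega

end Confirm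

/-! ### Assembling the invariant and estimating the bounds -/

section Final

variable {α : Type u} {Ψ : Type v} {A : PredAlg α Ψ} {Λ : PredLearner α Ψ} {L : Language α}
  {E K e c m : ℕ}

theorem sat_learner (hL : (Res L).Finite) (hlearn : ∀ D ∈ arisingSets L, Learns A Λ D)
    (s : Ctrl α) (hI : Inv A Λ L E K s e c m) :
    LSat A Λ L E K (ctrlRank A Λ L s) (learner A Λ s) e c m := by
  cases s with
  | build T =>
    obtain ⟨U, V, rfl, hS⟩ := hI
    exact sat_buildHypothesis hL hS
  | update T h q q' todo =>
    obtain ⟨U, V, rfl, hS, hq, htodo, heq⟩ := hI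
    exact sat_updateTransition hL hlearn hS hq htodo heq
  | confirm T h =>
    obtain ⟨U, V, rfl, hS, heq⟩ := hI
    exact hS.sat_confirm ⟨hL, hlearn, heq, le_rfl⟩

theorem sat_initial (hL : (Res L).Finite) :
    LSat A Λ L E K (toLex (2 * (4 * (Res L).ncard ^ 2) + 2, toLex (0, 0)))
      (initial A : LConfig A).prog 0 0 0 := by
  classical
  have hS : State A Λ L E K {[]} {[]} (fun _ _ => []) 0
      (0 + ((Finset.image₂ (· ++ ·) ({[]} : Finset (List α)) {[]}).card -
        (Finset.image₂ (· ++ ·) (∅ : Finset (List α)) ∅).card)) 0 0 0 := by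
    refine ⟨tableInv_init hL, by simp, fun _ _ => .nil, fun _ => Nat.zero_le _, fun _ _ => ?_⟩
    unfold mqBound
    have : (Finset.image₂ (· ++ ·) ({[]} : Finset (List α)) {[]}).card = 1 := by simp
    have h0 : (Finset.image₂ (· ++ ·) (∅ : Finset (List α)) ∅).card = 0 := by simp
    omega
  have h0 : (⟨∅, ∅, ∅⟩ : Table α) = tab L ∅ ∅ := by
    unfold tab
    congr 1
    ext z
    simp
  unfold initial
  rw [h0]
  refine sat_extend_of_build (Finset.empty_subset _) (Finset.empty_subset _) ?_
    ⟨⟨_, _, rfl, hS⟩, ?_⟩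
  · refine State.bounded hL (State.mono hS ?_ ?_)
    · omega
    · omega
  · refine Prod.Lex.toLex_lt_toLex.2 (.inl ?_)
    simp only [tab]
    omega

/-- A maximal interaction stops at an equivalence query, as a membership query can always be
answered. Thus `E ≥ 1` absorbs additive terms. -/
theorem one_le_of_maxEQ_le (hlearn : ∀ D ∈ arisingSets L, Learns A Λ D)
    (hE : maxEQ A Λ L ≤ E) : 1 ≤ E := by
  have hD := target_mem_arising L ∅ [] []
  have hwf := isWellFounded_continues (hlearn _ hD)
  obtain ⟨h, hh, hmin⟩ := hwf.wf.has_min {h | Interaction A Λ (target L ∅ [] []) h} ⟨[], .nil⟩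
  rcases hΛ : Λ h with a | φ
  · exact absurd ⟨⟨_, rfl⟩, .mq hh hΛ⟩ (hmin _ (.mq hh hΛ))
  · have h1 : (numEQ Λ h : ℕ∞) ≤ maxEQ A Λ L :=
      (le_iSup₂ (f := fun h (_ : Interaction A Λ (target L ∅ [] []) h) => (numEQ Λ h : ℕ∞))
        h hh).trans (le_iSup₂ (f := fun D (_ : D ∈ arisingSets L) => costEQ A Λ D) _ hD)
    have h2 : numEQ Λ h ≤ E := Nat.cast_le.1 (h1.trans hE)
    simp only [numEQ, hΛ] at h2
    omega

/-- The factor 10 would do; 184 is what the bound on MQs needs. -/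
theorem eqs_bound {n E : ℕ} (hn : 1 ≤ n) (hE : 1 ≤ E) :
    (4 * n ^ 2 + 1) * (1 + n ^ 2 * E) ≤ 184 * (n ^ 4 * E) := by
  have h1 : 1 ≤ n ^ 2 := Nat.one_le_pow _ _ hn
  have h2 : 1 ≤ n ^ 2 * E := Nat.mul_pos h1 hE
  calc (4 * n ^ 2 + 1) * (1 + n ^ 2 * E) ≤ (5 * n ^ 2) * (2 * (n ^ 2 * E)) :=
        Nat.mul_le_mul (by omega) (by omega)
    _ = 10 * (n ^ 4 * E) := by ring
    _ ≤ 184 * (n ^ 4 * E) := Nat.mul_le_mul_right _ (by norm_num)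

/-- A term linear in `n` suffices for `log n`, since it gets multiplied by `n` and `roundBound`
contains `n²` anyway. -/
theorem clog_add_le (n m : ℕ) :
    Nat.clog 2 (m + 4 * n ^ 2) ≤ Nat.clog 2 m + 2 * n + 3 := by
  refine Nat.clog_le_of_le_pow ?_
  have h1 : m ≤ 2 ^ Nat.clog 2 m := Nat.le_pow_clog (by norm_num) m
  have h2 : n ^ 2 ≤ 2 ^ (2 * n) := by
    rw [mul_comm, pow_mul]
    exact Nat.pow_le_pow_left (Nat.lt_two_pow_self).le 2
  have h3 : 1 ≤ 2 ^ Nat.clog 2 m := Nat.one_le_two_pow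
  have h4 : 1 ≤ 2 ^ (2 * n) := Nat.one_le_two_pow
  rw [pow_add, pow_add]
  nlinarith

theorem clog_le_log (m : ℕ) : (Nat.clog 2 m : ℝ) ≤ 2 * Real.log m + 1 := by
  have h1 : Nat.clog 2 m ≤ Nat.log 2 m + 1 :=
    Nat.clog_le_of_le_pow (Nat.lt_pow_succ_log_self (by norm_num) m).le
  have h2 : (Nat.log 2 m : ℝ) ≤ Real.logb 2 m := by exact_mod_cast Real.natLog_le_logb m 2
  have h3 : Real.logb 2 m ≤ 2 * Real.log m := by
    rw [Real.logb, div_le_iff₀ (Real.log_pos (by norm_num))]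
    have := Real.log_two_gt_d9
    have := Real.log_natCast_nonneg m
    nlinarith
  have h4 : (Nat.clog 2 m : ℝ) ≤ Nat.log 2 m + 1 := by exact_mod_cast h1
  linarith

theorem mqs_bound {n E K m : ℕ} (hn : 1 ≤ n) (hE : 1 ≤ E) :
    ((4 * n ^ 3 + (4 * n ^ 2 + 1) * phaseBound n E K m : ℕ) : ℝ) ≤
      (184 : ℕ) * ((n : ℝ) ^ 6 * ((E : ℝ) + K) + (n : ℝ) ^ 5 * E * Real.log m) := by
  have hl : 0 ≤ Real.log m := Real.log_natCast_nonneg m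
  have hn' : (1 : ℝ) ≤ n := by exact_mod_cast hn
  have hE' : (1 : ℝ) ≤ E := by exact_mod_cast hE
  have hK' : (0 : ℝ) ≤ K := Nat.cast_nonneg K
  have hclog : (Nat.clog 2 (m + 4 * n ^ 2) : ℝ) ≤ 2 * Real.log m + 2 * n + 4 := by
    have h1 : (Nat.clog 2 (m + 4 * n ^ 2) : ℝ) ≤ Nat.clog 2 m + 2 * n + 3 := by
      exact_mod_cast clog_add_le n m
    have := clog_le_log m
    linarith
  have hn2 : (n : ℝ) ≤ (n : ℝ) ^ 2 := by nlinarith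
  have hn1 : (1 : ℝ) ≤ (n : ℝ) ^ 2 := by nlinarith
  have hround : (roundBound n m : ℝ) ≤ 18 * (n : ℝ) ^ 2 + 2 * n * Real.log m := by
    unfold roundBound
    push_cast
    have := mul_le_mul_of_nonneg_left hclog (zero_le_one.trans hn')
    nlinarith
  have hnE : (1 : ℝ) ≤ (n : ℝ) ^ 2 * E := one_le_mul_of_one_le_of_one_le hn1 hE'
  have hround0 : (0 : ℝ) ≤ roundBound n m := Nat.cast_nonneg _
  have hphase : (phaseBound n E K m : ℝ) ≤ 4 * (n : ℝ) ^ 4 * K + 36 * (n : ℝ) ^ 4 * E +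
      4 * (n : ℝ) ^ 3 * E * Real.log m := by
    unfold phaseBound
    push_cast
    calc (n : ℝ) ^ 2 * (K * (4 * (n : ℝ) ^ 2)) + (n : ℝ) ^ 2 * (E * roundBound n m) +
          roundBound n m
        = 4 * (n : ℝ) ^ 4 * K + ((n : ℝ) ^ 2 * E + 1) * roundBound n m := by ring
      _ ≤ 4 * (n : ℝ) ^ 4 * K + (2 * ((n : ℝ) ^ 2 * E)) *
          (18 * (n : ℝ) ^ 2 + 2 * n * Real.log m) := by
        gcongr
        linarith
      _ = _ := by ring
  have hphase0 : (0 : ℝ) ≤ phaseBound n E K m := Nat.cast_nonneg _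
  have hn3 : (n : ℝ) ^ 3 ≤ (n : ℝ) ^ 6 := pow_le_pow_right₀ hn' (by norm_num)
  have hn6E : (n : ℝ) ^ 6 ≤ (n : ℝ) ^ 6 * E := le_mul_of_one_le_right (by positivity) hE'
  have hn6K : (0 : ℝ) ≤ (n : ℝ) ^ 6 * K := by positivity
  have hn5 : (0 : ℝ) ≤ (n : ℝ) ^ 5 * E * Real.log m := by positivity
  push_cast
  calc 4 * (n : ℝ) ^ 3 + (4 * (n : ℝ) ^ 2 + 1) * phaseBound n E K m
      ≤ 4 * (n : ℝ) ^ 3 + (5 * (n : ℝ) ^ 2) * (4 * (n : ℝ) ^ 4 * K + 36 * (n : ℝ) ^ 4 * E +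
          4 * (n : ℝ) ^ 3 * E * Real.log m) := by
        gcongr
        linarith
    _ = 4 * (n : ℝ) ^ 3 + 20 * ((n : ℝ) ^ 6 * K) + 180 * ((n : ℝ) ^ 6 * E) +
          20 * ((n : ℝ) ^ 5 * E * Real.log m) := by ring
    -- The term `4n³` is at most `4n⁶E`, which raises 180 to 184.
    _ ≤ _ := by nlinarith

end Final

end RSFA

theorem theorem2 :
    ∃ C : ℕ, ∀ (α : Type u) (Ψ : Type v) (A : RSFA.PredAlg α Ψ) (Λ : RSFA.PredLearner α Ψ),
      RSFA.IsMATLearner A Λ →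
      ∀ (S : Type w) (M : RSFA.SFA A S) (L : Language α), M.lang = L →
        -- every run terminates
        (¬ ∃ f : ℕ → RSFA.LConfig A, f 0 = RSFA.initial A ∧
          ∀ i, RSFA.LStep A Λ L (f i) (f (i + 1))) ∧
        -- no run gets stuck before it returns an automaton
        (∀ c, RSFA.Reachable A Λ L c →
          (∃ H, c.prog = .halt H) ∨ ∃ c', RSFA.LStep A Λ L c c') ∧
        -- the automaton returned is a reduced RSFA accepting `L`
        (∀ c, RSFA.Reachable A Λ L c → ∀ H, c.prog = .halt H →
          H.IsResidual ∧ H.IsReduced ∧ H.lang = L) ∧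
        -- bound on the number of EQs
        (∀ c, RSFA.Reachable A Λ L c → ∀ E : ℕ, RSFA.maxEQ A Λ L ≤ E →
          c.eqs ≤ C * ((RSFA.Res L).ncard ^ 4 * E)) ∧
        -- bound on the number of MQs
        (∀ c, RSFA.Reachable A Λ L c → ∀ E K : ℕ, RSFA.maxEQ A Λ L ≤ E → RSFA.maxMQ A Λ L ≤ K →
          (c.mqs : ℝ) ≤ C * (((RSFA.Res L).ncard : ℝ) ^ 6 * ((E : ℝ) + K) +
            ((RSFA.Res L).ncard : ℝ) ^ 5 * E * Real.log c.maxCE)) := by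
  refine ⟨184, ?_⟩
  rintro α Ψ A Λ hΛ S M L rfl
  have hL : (RSFA.Res M.lang).Finite := M.finite_Res
  have hlearn : ∀ D ∈ RSFA.arisingSets M.lang, RSFA.Learns A Λ D := by
    intro D hD
    obtain ⟨ψ, rfl⟩ := RSFA.exists_den_of_arising M hD
    exact hΛ ψ
  have hn := RSFA.one_le_ncard_Res hL
  have hreach : ∀ E K c, RSFA.Reachable A Λ M.lang c →
      RSFA.Sat RSFA.SFA.lang M.lang (RSFA.Inv A Λ M.lang E K) (RSFA.Correct A M.lang)
        (RSFA.Bounded A Λ M.lang E K) c.prog c.eqs c.mqs c.maxCE := by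
    intro E K c hc
    refine RSFA.Sat.reachable (body := RSFA.learner A Λ) (fun s e c m hI => ?_) ?_ hc
    · exact (RSFA.sat_learner hL hlearn s hI).mono fun _ _ _ _ h => h.1
    · exact (RSFA.sat_initial hL).mono fun _ _ _ _ h => h.1
  have hbounded : ∀ E K c, RSFA.Reachable A Λ M.lang c →
      RSFA.Bounded A Λ M.lang E K c.eqs c.mqs c.maxCE := fun E K c hc =>
    (hreach E K c hc).bound fun _ _ _ _ h h' => h'.antitone h
  refine ⟨?_, ?_, ?_, ?_, ?_⟩
  -- The bounds in the invariant are conditional on `E` and `K`, so any values serve for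
  -- termination.
  · have hacc := RSFA.Sat.acc (rank := RSFA.ctrlRank A Λ M.lang)
      (Inv := RSFA.Inv A Λ M.lang 0 0) (body := RSFA.learner A Λ)
      (fun s _ _ _ hI => RSFA.sat_learner hL hlearn s hI) _ _ _ _ _ (RSFA.sat_initial hL)
    rintro ⟨f, hf0, hf⟩
    exact not_acc_iff_exists_descending_chain.2 ⟨f, hf0, hf⟩ hacc
  · exact fun c hc => (hreach 0 0 c hc).progress
  · intro c hc H hH
    have h := hreach 0 0 c hc
    rw [hH] at h
    exact h.2
  · intro c hc E hE
    exact ((hbounded E 0 c hc).1 hE).trans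
      (RSFA.eqs_bound hn (RSFA.one_le_of_maxEQ_le hlearn hE))
  · intro c hc E K hE hK
    exact (Nat.cast_le.2 ((hbounded E K c hc).2 hE hK)).trans
      (RSFA.mqs_bound hn (RSFA.one_le_of_maxEQ_le hlearn hE))
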